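/- **Setting.** Let $V$ be a finite set of nodes and $V_{ok}\subseteq V$ the set of correct nodes; the other nodes are faulty (Byzantine). An *FBQS* $S$ assigns to every $v\in V$ a non-empty family $S(v)$ of *slices*, each a subset of $V$ that contains $v$. A *quorum* is a non-empty $U\subseteq V$ such that every $u\in U$ has a slice $q\in S(u)$ with $q\subseteq U$; a set $B$ is *$v$-blocking* if it meets every slice of $v$; the projection $S|_I$ is the FBQS over $I$ with slices $q\cap I$, $q\in S(v)$. Two correct nodes are *intertwined* if every quorum containing the one meets every quorum containing the other in a correct node. A set $I\subseteq V_{ok}$ is *intact* in $S$ if $I$ is a quorum in $S$ and its members are pairwise intertwined in $S|_I$. A *subjective FBQS* is a family $\{S_v\}_{v\in V_{ok}}$ of FBQSs (the views of the correct nodes) with $S_{v_1}(v)=S_{v_2}(v)$ for all $v,v_1,v_2\in V_{ok}$; a non-empty set $I\subseteq V_{ok}$ is intact in it if it is intact in $S_v$ for each $v\in I$. Let $\mathrm{Val}$ be a totally ordered set. *Ballots* are the pairs $b=\langle n,x\rangle$ with round $b.n=n\ge 1$ and value $b.x=x\in\mathrm{Val}$, ordered lexicographically, together with the least ballot $\langle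 0,\bot\rangle$, where $\bot\notin \mathrm{Val}$. Write $b'\prec b$ if $b'<b$ and $b'.x\ne b.x$, and say that $b_u$ *covers* $b$ if every $b'\prec b$ satisfies $b'\prec b_u$. **Common part of both protocols.** Each correct node $v$ uses the quorums and blocking sets of its own view $S_v$. It keeps ballots $\mathit{cand}$ and $\mathit{prep}$, initially null, and a round, initially $0$. It proposes at most once; on $\mathrm{propose}(x)$ it sets $\mathit{cand}:=\langle 1,x\rangle$ and *prepares* $\mathit{cand}$. When its timer expires, which can happen only after the timer has been started, it sets $\mathit{cand}:=\langle \mathit{round}+1,y\rangle$, where $y$ is $\mathit{cand}.x$ if $\mathit{prep}$ is null and $\mathit{prep}.x$ otherwise ($\mathit{cand}$ stays null if $y=\bot$), and prepares $\mathit{cand}$. When it *has prepared* a ballot $b>\mathit{prep}$, it sets $\mathit{prep}:=b$ and, if $\mathit{cand}\le b$, it also sets $\mathit{cand}:=b$ and *commits* $b$. When it *has committed* a ballot $b$ with $b.x\neq\bot$, it triggers $\mathrm{decide}(b.x)$ and stops. When there are a quorum $U\ni v$ and ballots $b_u$, $u\in U$, with $b_u.n>\mathit{round}$, each of them *endorsed*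 by $u$, it sets $\mathit{round}:=\min_{u\in U} b_u.n$ and starts its timer. Every message is sent to all nodes. **ASCP** (abstract protocol). For each ballot $b$ every node runs an instance of federated voting: the first invocation $\mathrm{vote}(a)$, $a$ a Boolean, sends $\mathrm{VOTE}(b,a)$, and later ones are ignored; on $\mathrm{VOTE}(b,a)$ from all members of a quorum containing $v$, or on $\mathrm{READY}(b,a)$ from all members of a $v$-blocking set, $v$ sends $\mathrm{READY}(b,a)$ unless it has already sent a ready message for $b$; on $\mathrm{READY}(b,a)$ from all members of a quorum containing $v$, $v$ delivers $a$ for $b$ unless it has already delivered a Boolean for $b$. Preparing $b$ means voting $\mathit{false}$ for every $b'\prec b$; $v$ has prepared $b$ when it has delivered $\mathit{false}$ for every $b'\prec b$; committing $b$ means voting $\mathit{true}$ for $b$; $v$ has committed $b$ when it has delivered $\mathit{true}$ for $b$. Node $u$ endorses $b_u$ (at $v$) if, for $M=\mathrm{VOTE}$ or $M=\mathrm{READY}$, $v$ has received from $u$ either $M(b_u,\mathit{true})$ or, for some $z<b_u$, all the messages $M(b',\mathit{false})$ with $z\le b'<b_u$. Messages are exchanged in (possibly infinite) batches. **CSCP**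 (concrete protocol). Nodes exchange the messages $\mathrm{VOTE}(s)$, $\mathrm{READY}(s)$ with statements $s$ of the form $\mathrm{prep}\,b$ or $\mathrm{cmt}\,b$. A node keeps ballots $p_V,p_R,p_D$, initially null, and finite sets $C_V,C_R,C_D$ of ballots, initially empty. Preparing $b$: if $p_V<b$, set $p_V:=b$ and send $\mathrm{VOTE}(\mathrm{prep}\,b)$. If there is a maximum $b>p_R$ for which there is a quorum containing $v$ from each of whose members $u$ node $v$ has received some $\mathrm{VOTE}(\mathrm{prep}\,b_u)$ with $b_u$ covering $b$ (respectively, for which there is a $v$-blocking set from each of whose members $u$ node $v$ has received some $\mathrm{READY}(\mathrm{prep}\,b_u)$ with $b_u$ covering $b$), set $p_R:=b$ and send $\mathrm{READY}(\mathrm{prep}\,b)$. If there is a maximum $b>p_D$ for which there is a quorum containing $v$ from each of whose members $u$ node $v$ has received some $\mathrm{READY}(\mathrm{prep}\,b_u)$ with $b_u$ covering $b$, set $p_D:=b$; then $v$ has prepared $b$. Committing $b$: if $b\notin C_V$ and $p_V=b$, add $b$ to $C_V$ and send $\mathrm{VOTE}(\mathrm{cmt}\,b)$. On $\mathrm{VOTE}(\mathrm{cmt}\,b)$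 from a quorum containing $v$, or $\mathrm{READY}(\mathrm{cmt}\,b)$ from a $v$-blocking set, if $b\notin C_R$, add $b$ to $C_R$ and send $\mathrm{READY}(\mathrm{cmt}\,b)$. On $\mathrm{READY}(\mathrm{cmt}\,b)$ from a quorum containing $v$, if $b\notin C_D$, add $b$ to $C_D$; then $v$ has committed $b$. Node $u$ endorses $b_u$ (at $v$) if $v$ has received from $u$ a vote or ready message with statement $\mathrm{prep}\,b_u$ or $\mathrm{cmt}\,b_u$. **Executions.** An execution is a finite or infinite sequence of steps from the initial configuration. In each step one correct node that has not stopped atomically runs one enabled handler, or receives a message (in ASCP, a batch) that it has not yet received from that sender; it may receive from a correct node only what that node has sent, and anything from a faulty node. The trace of an execution is the sequence of its events at correct nodes (invocations, indications, timer events, sends and receives, batched in ASCP). For a trace $\tau$ and a set $I$, $\tau|_I$ is the subsequence of the events at nodes in $I$, and the history $H(\tau)$ is the subsequence of the events $v.\mathrm{propose}(x)$ and $v.\mathrm{decide}(x)$. **Theorem.** Let $\{S_v\}_{v\in V_{ok}}$ be a subjective FBQS and $I$ an intact set in it. For every execution of CSCP over $\{S_v\}_{v\in V_{ok}}$ with trace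 $\tau$ there is an execution of ASCP over $\{S_v\}_{v\in V_{ok}}$ with trace $\rho$ such that $H(\tau|_I)=H(\rho|_I)$. -/

import Mathlib

/-! ## Federated Byzantine quorum systems -/

/-- A federated Byzantine quorum system over the universe `V`: every node has a non-empty
family of quorum slices, each of which contains the node itself. -/
structure FBQS (V : Type*) where
  slices : V → Set (Set V)
  nonempty : ∀ v, (slices v).Nonempty
  self_mem : ∀ v, ∀ q ∈ slices v, v ∈ q

namespace FBQS

variable {V : Type*}

/-- A quorum is a non-empty set that contains a slice of each of its members. -/
def IsQuorum (S : FBQS V) (U : Set V) : Prop :=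
  U.Nonempty ∧ ∀ v ∈ U, ∃ q ∈ S.slices v, q ⊆ U

/-- `B` is `v`-blocking when it overlaps each slice of `v`. -/
def IsBlocking (S : FBQS V) (v : V) (B : Set V) : Prop :=
  ∀ q ∈ S.slices v, (q ∩ B).Nonempty

/-- The projection of `S` to `I`: the FBQS over the universe `I` whose slices are the sets
`q ∩ I`, for `q` a slice of `S`. -/
def proj (S : FBQS V) (I : Set V) : FBQS I where
  slices v := {p | ∃ q ∈ S.slices v, p = Subtype.val ⁻¹' q}
  nonempty v := by
    obtain ⟨q, hq⟩ := S.nonempty v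
    exact ⟨_, q, hq, rfl⟩
  self_mem := by
    rintro v _ ⟨q, hq, rfl⟩
    exact S.self_mem v q hq

/-- Two nodes are intertwined when they are correct and every quorum containing the one
intersects every quorum containing the other in some correct node. -/
def Intertwined (S : FBQS V) (ok : Set V) (v v' : V) : Prop :=
  v ∈ ok ∧ v' ∈ ok ∧ ∀ U U' : Set V, S.IsQuorum U → S.IsQuorum U' → v ∈ U → v' ∈ U' →
    (U ∩ U' ∩ ok).Nonempty

/-- An intact set is a quorum of correct nodes whose members are pairwise intertwined in the
projected system. -/
def IsIntact (S : FBQS V) (ok I : Set V) : Prop :=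
  I ⊆ ok ∧ S.IsQuorum I ∧
    ∀ v v' : I, (S.proj I).Intertwined (Subtype.val ⁻¹' ok) v v'

end FBQS

/-- A subjective FBQS: each correct node `v` has its own view `view v` of the whole system, and
the views agree on the slices of the correct nodes (only faulty nodes may equivocate). -/
structure SubjectiveFBQS {V : Type*} (ok : Set V) where
  view : ok → FBQS V
  agree : ∀ v₁ v₂ v : ok, (view v₁).slices v = (view v₂).slices v

/-- `I` is an intact set of a subjective FBQS when it is a non-empty set of correct nodes that is
intact in the view of each of its members. -/
def SubjectiveFBQS.IsIntact {V : Type*} {ok : Set V} (F : SubjectiveFBQS ok) (I : Set V) : Prop :=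
  I.Nonempty ∧ I ⊆ ok ∧ ∀ v : ok, (v : V) ∈ I → (F.view v).IsIntact ok I

/-! ## Ballots -/

/-- Ballots: the pairs `⟨n, x⟩` of a positive round and a value, in lexicographic order, together
with the null ballot `⊥ = ⟨0, ⊥⟩` below all of them. -/
abbrev Ballot (Val : Type*) := WithBot (ℕ+ ×ₗ Val)

namespace Ballot

variable {Val : Type*}

/-- The ballot `⟨n, x⟩`. -/
def mk (n : ℕ+) (x : Val) : Ballot Val := WithBot.some (toLex (n, x))

/-- The round `b.n` (`0` for the null ballot). -/
def round (b : Ballot Val) : ℕ :=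
  WithBot.recBotCoe (C := fun _ => ℕ) 0 (fun p => ((ofLex p).1 : ℕ)) b

/-- The value `b.x` (`none` stands for the value `⊥` of the null ballot). -/
def val (b : Ballot Val) : Option Val :=
  WithBot.recBotCoe (C := fun _ => Option Val) none (fun p => some (ofLex p).2) b

/-- `b` is below and incompatible than `b'`. -/
def Lic [LinearOrder Val] (b b' : Ballot Val) : Prop := b < b' ∧ b.val ≠ b'.val

/-- Every ballot below and incompatible than `b` is below and incompatible than `c`. -/
def CoveredBy [LinearOrder Val] (b c : Ballot Val) : Prop := ∀ b' : Ballot Val, b'.Lic b → b'.Lic c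

end Ballot

/-! ## Events, traces and histories -/

/-- The events of histories. -/
inductive HistEvent (V Val : Type*)
  | propose (v : V) (x : Val)
  | decide (v : V) (x : Val)

/-- The node at which an event of a history occurs. -/
def HistEvent.node {V Val : Type*} : HistEvent V Val → V
  | .propose v _ => v
  | .decide v _ => v

inductive MsgKind
  | vote
  | ready

/-- Statements of bunched voting. -/
inductive Stmt (Val : Type*)
  | prep (b : Ballot Val)
  | cmt (b : Ballot Val)

/-- Concrete messages `VOTE(s)` and `READY(s)`. -/
structure CMsg (Val : Type*) where
  kind : MsgKind
  stmt : Stmt Val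

/-- Abstract messages `VOTE(b, a)` and `READY(b, a)`. -/
structure AMsg (Val : Type*) where
  kind : MsgKind
  ballot : Ballot Val
  bool : Bool

/-- A batch of abstract messages, possibly infinite. The messages of a batch are ordered by their
ballots, so that a batch is given by the set of its messages. -/
abbrev Batch (Val : Type*) := Set (AMsg Val)

/-- The events of concrete traces. In `send v m v'` node `v` sends `m` to `v'`, and in
`receive v m v'` node `v` receives `m` from `v'`. -/
inductive CEvent (V Val : Type*)
  | hist (e : HistEvent V Val)
  | prepare (v : V) (b : Ballot Val)
  | commit (v : V) (b : Ballot Val)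
  | prepared (v : V) (b : Ballot Val)
  | committed (v : V) (b : Ballot Val)
  | startTimer (v : V) (n : ℕ)
  | timeout (v : V)
  | send (v : V) (m : CMsg Val) (v' : V)
  | receive (v : V) (m : CMsg Val) (v' : V)

/-- The events of abstract traces. -/
inductive AEvent (V Val : Type*)
  | hist (e : HistEvent V Val)
  | startTimer (v : V) (n : ℕ)
  | timeout (v : V)
  | voteBatch (v : V) (bs : Set (Ballot Val)) (a : Bool)
  | deliverBatch (v : V) (bs : Set (Ballot Val)) (a : Bool)
  | sendBatch (v : V) (ms : Batch Val) (v' : V)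
  | receiveBatch (v : V) (ms : Batch Val) (v' : V)

namespace CEvent

variable {V Val : Type*}

def node : CEvent V Val → V
  | hist e => e.node
  | prepare v _ => v
  | commit v _ => v
  | prepared v _ => v
  | committed v _ => v
  | startTimer v _ => v
  | timeout v => v
  | send v _ _ => v
  | receive v _ _ => v

def toHist : CEvent V Val → Option (HistEvent V Val)
  | hist e => some e
  | _ => none

end CEvent

namespace AEvent

variable {V Val : Type*}

def node : AEvent V Val → V
  | hist e => e.node
  | startTimer v _ => v
  | timeout v => v
  | voteBatch v _ _ => v
  | deliverBatch v _ _ => v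
  | sendBatch v _ _ => v
  | receiveBatch v _ _ => v

def toHist : AEvent V Val → Option (HistEvent V Val)
  | hist e => some e
  | _ => none

end AEvent

/-- A finite or infinite sequence: `τ k` is its entry number `k`, and `none` past its end. -/
abbrev Trace (E : Type*) := ℕ → Option E

namespace Trace

variable {E E' : Type*}

/-- The concatenation `ℓ 0 ++ ℓ 1 ++ ⋯ ++ ℓ (n - 1)`. -/
def upTo (ℓ : ℕ → List E) (n : ℕ) : List E := (List.range n).flatMap ℓ

open Classical in
/-- The finite or infinite concatenation `ℓ 0 ++ ℓ 1 ++ ⋯`. -/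
noncomputable def concat (ℓ : ℕ → List E) : Trace E := fun k =>
  if h : ∃ n, k < (upTo ℓ n).length then (upTo ℓ (Nat.find h))[k]? else none

/-- The sequence of the values `f e`, for the entries `e` of `τ` in order, where the entries with
`f e = none` are removed. -/
noncomputable def filterMap (f : E → Option E') (τ : Trace E) : Trace E' :=
  concat fun k => (τ k).toList.filterMap f

open Classical in
/-- The projection of a trace to the events of the nodes in `I`. -/
noncomputable def project {V : Type*} (node : E → V) (I : Set V) (τ : Trace E) : Trace E :=
  filterMap (fun e => if node e ∈ I then some e else none) τ

end Trace

/-- The `I`-projection of a concrete trace. -/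
noncomputable def CEvent.project {V Val : Type*} (I : Set V) (τ : Trace (CEvent V Val)) :
    Trace (CEvent V Val) := Trace.project CEvent.node I τ

/-- The history of a concrete trace. -/
noncomputable def CEvent.history {V Val : Type*} (τ : Trace (CEvent V Val)) :
    Trace (HistEvent V Val) := Trace.filterMap CEvent.toHist τ

/-- The `I`-projection of an abstract trace. -/
noncomputable def AEvent.project {V Val : Type*} (I : Set V) (τ : Trace (AEvent V Val)) :
    Trace (AEvent V Val) := Trace.project AEvent.node I τ

/-- The history of an abstract trace. -/
noncomputable def AEvent.history {V Val : Type*} (τ : Trace (AEvent V Val)) :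
    Trace (HistEvent V Val) := Trace.filterMap AEvent.toHist τ

/-! ## Asynchronous systems with Byzantine nodes and authenticated links -/

/-- A configuration: the local state of each node, the payloads that a node has sent (every
payload is sent to every node), and the payloads `rcvd v u` that `v` has received from `u`. -/
structure Config (V N M : Type*) where
  node : V → N
  sent : V → Set M
  rcvd : V → V → Set M

/-- The events of sending the payload `o`, if any, to every node. -/
noncomputable def sendEvents {V M E : Type*} [Fintype V] (sendE : V → M → V → E) (v : V)
    (o : Option M) : List E :=
  o.toList.flatMap fun m => (Finset.univ : Finset V).toList.map (sendE v m)

/-- One step of a system whose correct nodes run the handlers `loc`: `loc v rc n es o n'` says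
that `v` in local state `n`, having received the payloads `rc u` from each `u`, can atomically
trigger the events `es`, go to state `n'` and send the payload `o` (if any) to every node.
Faulty nodes are arbitrary: any payload may arrive from them. A payload arrives from a correct
node only after that node has sent it. The idle step lets an execution be finite. -/
inductive NetStep {V N M E : Type*} [Fintype V] [DecidableEq V] (ok : Set V)
    (stopped : N → Bool)
    (loc : ok → (V → Set M) → N → List E → Option M → N → Prop)
    (sendE recvE : V → M → V → E) : Config V N M → List E → Config V N M → Prop
  | act (c : Config V N M) (v : ok) (es : List E) (o : Option M) (n' : N)
      (hs : stopped (c.node v) = false)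
      (h : loc v (c.rcvd v) (c.node v) es o n') :
      NetStep ok stopped loc sendE recvE c (es ++ sendEvents sendE (v : V) o)
        { node := Function.update c.node v n'
          sent := Function.update c.sent v (c.sent v ∪ {m | o = some m})
          rcvd := c.rcvd }
  | receive (c : Config V N M) (v : ok) (u : V) (m : M)
      (hs : stopped (c.node v) = false)
      (hnew : m ∉ c.rcvd v u)
      (hsent : u ∈ ok → m ∈ c.sent u) :
      NetStep ok stopped loc sendE recvE c [recvE v m u]
        { node := c.node
          sent := c.sent
          rcvd := Function.update c.rcvd v (Function.update (c.rcvd v) u (insert m (c.rcvd v u))) }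
  | idle (c : Config V N M) : NetStep ok stopped loc sendE recvE c [] c

/-- An execution: a run of the step relation from the configuration in which every node has local
state `init` and no payload has been sent or received. -/
structure Execution {V N M E : Type*} (init : N)
    (step : Config V N M → List E → Config V N M → Prop) where
  cfg : ℕ → Config V N M
  events : ℕ → List E
  start : cfg 0 = { node := fun _ => init, sent := fun _ => ∅, rcvd := fun _ _ => ∅ }
  step : ∀ n, step (cfg n) (events n) (cfg (n + 1))

/-- The trace that an execution entails. -/
noncomputable def Execution.trace {V N M E : Type*} {init : N}
    {step : Config V N M → List E → Config V N M → Prop} (X : Execution init step) : Trace E :=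
  Trace.concat X.events

/-! ## The fields common to both consensus protocols -/

/-- The candidate ballot, the highest prepared ballot and the current round of a node; whether its
timer is running, whether it has proposed, and whether it has stopped after deciding. -/
structure Consensus (Val : Type*) where
  cand : Ballot Val
  prepared : Ballot Val
  round : ℕ
  timer : Bool
  proposed : Bool
  stopped : Bool

/-- The initial values of the common fields. -/
def Consensus.init (Val : Type*) : Consensus Val :=
  { cand := ⊥, prepared := ⊥, round := 0, timer := false, proposed := false, stopped := false }

/-- The candidate ballot after a timeout: the next round, with the value of the highest prepared
ballot or, if no ballot has been prepared, of the current candidate. (A node that has neither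
a candidate nor a prepared ballot has no value to propose, and its candidate stays null.) -/
def Consensus.nextCand {Val : Type*} [LinearOrder Val] (c : Consensus Val) : Ballot Val :=
  match (if c.prepared = ⊥ then c.cand else c.prepared).val with
  | some x => Ballot.mk (Nat.succPNat c.round) x
  | none => ⊥

/-! ## The abstract protocol -/

namespace ASCP

variable {V Val : Type*}

/-- The local state of a node. The fields `voted`, `ready` and `delivered` collect the states of
the federated voting instances of all ballots: the ballots whose instance has voted, has sent a
ready message, or has delivered a Boolean (which is then recorded). -/
structure Node (Val : Type*) where
  cons : Consensus Val
  voted : Set (Ballot Val)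
  ready : Set (Ballot Val)
  delivered : Ballot Val → Option Bool

def Node.init (Val : Type*) : Node Val :=
  { cons := Consensus.init Val, voted := ∅, ready := ∅, delivered := fun _ => none }

/-- The node has received the message `m`, as part of some batch, from the node whose batches are
`bs`. -/
def Got (bs : Set (Batch Val)) (m : AMsg Val) : Prop := ∃ ms ∈ bs, m ∈ ms

/-- The batch that results from voting `a` in the instances of all ballots in `bs`: an instance
that has already voted ignores the invocation. -/
def Node.voteMsgs (n : Node Val) (bs : Set (Ballot Val)) (a : Bool) : Batch Val :=
  {m | ∃ b ∈ bs, b ∉ n.voted ∧ m = ⟨.vote, b, a⟩}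

/-- `u` endorses, by votes or by ready messages, committing the ballot `b` or aborting every ballot
of some non-empty right-open interval with upper bound `b`. -/
def Endorses [LinearOrder Val] (bs : Set (Batch Val)) (b : Ballot Val) : Prop :=
  ∃ M : MsgKind, Got bs ⟨M, b, true⟩ ∨
    ∃ z < b, ∀ b' ∈ Set.Ico z b, Got bs ⟨M, b', false⟩

/-- The handlers of abstract consensus and of its federated voting instances at node `v`, where `S`
is the view of `v`. -/
inductive Local [LinearOrder Val] (S : FBQS V) (v : V) (rc : V → Set (Batch Val)) (n : Node Val) :
    List (AEvent V Val) → Option (Batch Val) → Node Val → Prop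
  /-- Invocation `propose(x)`, once per node. -/
  | propose (x : Val) (hp : n.cons.proposed = false) :
      Local S v rc n
        [.hist (.propose v x), .voteBatch v {b' | b'.Lic (Ballot.mk 1 x)} false]
        (some (n.voteMsgs {b' | b'.Lic (Ballot.mk 1 x)} false))
        { n with
          cons := { n.cons with cand := Ballot.mk 1 x, proposed := true }
          voted := n.voted ∪ {b' | b'.Lic (Ballot.mk 1 x)} }
  /-- Federated voting: sending ready messages, for a quorum of votes or a blocking set of ready
  messages. -/
  | ready (bs : Set (Ballot Val)) (a : Bool) (hne : bs.Nonempty)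
      (h : ∀ b ∈ bs, b ∉ n.ready ∧
        ((∃ U, S.IsQuorum U ∧ v ∈ U ∧ ∀ u ∈ U, Got (rc u) ⟨.vote, b, a⟩) ∨
          ∃ B, S.IsBlocking v B ∧ ∀ u ∈ B, Got (rc u) ⟨.ready, b, a⟩)) :
      Local S v rc n [] (some {m | ∃ b ∈ bs, m = ⟨.ready, b, a⟩})
        { n with ready := n.ready ∪ bs }
  /-- Federated voting: delivering a Boolean, for a quorum of ready messages. -/
  | deliver (bs : Set (Ballot Val)) (a : Bool) (hne : bs.Nonempty)
      (d : Ballot Val → Option Bool)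
      (h : ∀ b ∈ bs, n.delivered b = none ∧
        ∃ U, S.IsQuorum U ∧ v ∈ U ∧ ∀ u ∈ U, Got (rc u) ⟨.ready, b, a⟩)
      (hd : ∀ b ∈ bs, d b = some a) (hd' : ∀ b ∉ bs, d b = n.delivered b) :
      Local S v rc n [.deliverBatch v bs a] none { n with delivered := d }
  /-- Preparing a ballot that stays below the candidate. -/
  | preparedLow (b : Ballot Val) (h : ∀ b' : Ballot Val, b'.Lic b → n.delivered b' = some false)
      (hlt : n.cons.prepared < b) (hc : ¬ n.cons.cand ≤ b) :
      Local S v rc n [] none { n with cons := { n.cons with prepared := b } }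
  /-- Preparing a ballot that reaches the candidate, and voting for committing it. -/
  | preparedHigh (b : Ballot Val) (h : ∀ b' : Ballot Val, b'.Lic b → n.delivered b' = some false)
      (hlt : n.cons.prepared < b) (hc : n.cons.cand ≤ b) :
      Local S v rc n [.voteBatch v {b} true] (some (n.voteMsgs {b} true))
        { n with
          cons := { n.cons with prepared := b, cand := b }
          voted := n.voted ∪ {b} }
  /-- Deciding the value of a ballot for which `true` has been delivered, and stopping. -/
  | decide (b : Ballot Val) (x : Val) (h : n.delivered b = some true) (hx : b.val = some x) :
      Local S v rc n [.hist (.decide v x)] none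
        { n with cons := { n.cons with stopped := true } }
  /-- Updating the round and starting the timer. -/
  | round (U : Set V) (bu : V → Ballot Val) (r : ℕ) (hU : S.IsQuorum U) (hv : v ∈ U)
      (h : ∀ u ∈ U, n.cons.round < (bu u).round ∧ Endorses (rc u) (bu u))
      (hr : IsLeast ((fun u => (bu u).round) '' U) r) :
      Local S v rc n [.startTimer v r] none
        { n with cons := { n.cons with round := r, timer := true } }
  /-- The timer expires. -/
  | timeout (ht : n.cons.timer = true) :
      Local S v rc n
        [.timeout v, .voteBatch v {b' | b'.Lic n.cons.nextCand} false]
        (some (n.voteMsgs {b' | b'.Lic n.cons.nextCand} false))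
        { n with
          cons := { n.cons with cand := n.cons.nextCand, timer := false }
          voted := n.voted ∪ {b' | b'.Lic n.cons.nextCand} }

/-- Executions of the abstract protocol over a subjective FBQS: each correct node uses the quorums
and blocking sets of its own view, and nodes exchange batches. -/
abbrev Exec [Fintype V] [DecidableEq V] (Val : Type*) [LinearOrder Val] {ok : Set V}
    (F : SubjectiveFBQS ok) :=
  Execution (V := V) (Node.init Val)
    (NetStep ok (fun n => n.cons.stopped) (fun v => Local (F.view v) (v : V))
      AEvent.sendBatch AEvent.receiveBatch)

end ASCP

/-! ## The concrete protocol -/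

namespace CSCP

variable {V Val : Type*}

/-- The fields of bunched voting. -/
structure BV (Val : Type*) where
  maxVotedPrep : Ballot Val
  maxReadiedPrep : Ballot Val
  maxDeliveredPrep : Ballot Val
  votedCmt : Finset (Ballot Val)
  readiedCmt : Finset (Ballot Val)
  deliveredCmt : Finset (Ballot Val)

/-- The local state of a node. -/
structure Node (Val : Type*) where
  cons : Consensus Val
  bv : BV Val

def Node.init (Val : Type*) : Node Val :=
  { cons := Consensus.init Val
    bv :=
      { maxVotedPrep := ⊥, maxReadiedPrep := ⊥, maxDeliveredPrep := ⊥
        votedCmt := ∅, readiedCmt := ∅, deliveredCmt := ∅ } }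

section

variable [LinearOrder Val]

/-- The invocation `prepare(b)` of bunched voting: the new state and the message sent. -/
def BV.prepare (s : BV Val) (b : Ballot Val) : BV Val × Option (CMsg Val) :=
  if s.maxVotedPrep < b then ({ s with maxVotedPrep := b }, some ⟨.vote, .prep b⟩) else (s, none)

/-- The invocation `commit(b)` of bunched voting. -/
def BV.commit (s : BV Val) (b : Ballot Val) : BV Val × Option (CMsg Val) :=
  if b ∉ s.votedCmt ∧ s.maxVotedPrep = b then
    ({ s with votedCmt := insert b s.votedCmt }, some ⟨.vote, .cmt b⟩)
  else (s, none)

/-- The handler of the indication `prepared(b)` of bunched voting. -/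
def Node.onPrepared (v : V) (n : Node Val) (b : Ballot Val) :
    List (CEvent V Val) × Option (CMsg Val) × Node Val :=
  if n.cons.prepared < b then
    if n.cons.cand ≤ b then
      ([.commit v b], (n.bv.commit b).2,
        { cons := { n.cons with prepared := b, cand := b }, bv := (n.bv.commit b).1 })
    else ([], none, { n with cons := { n.cons with prepared := b } })
  else ([], none, n)

/-- The handler of the indication `committed(b)`: deciding `b.x` and stopping. -/
def Node.onCommitted (v : V) (n : Node Val) (b : Ballot Val) : List (CEvent V Val) × Node Val :=
  match b.val with
  | some x => ([.hist (.decide v x)], { n with cons := { n.cons with stopped := true } })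
  | none => ([], n)

/-- There is a quorum of `S` containing `v` such that `v` has received from each member `u` a message of
kind `M` with a prepare statement that covers `b`. -/
def QuorumPrep (S : FBQS V) (v : V) (rc : V → Set (CMsg Val)) (M : MsgKind) (b : Ballot Val) :
    Prop :=
  ∃ U, S.IsQuorum U ∧ v ∈ U ∧ ∀ u ∈ U, ∃ bu : Ballot Val, ⟨M, .prep bu⟩ ∈ rc u ∧ b.CoveredBy bu

/-- The same for a `v`-blocking set. -/
def BlockingPrep (S : FBQS V) (v : V) (rc : V → Set (CMsg Val)) (M : MsgKind) (b : Ballot Val) :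
    Prop :=
  ∃ B, S.IsBlocking v B ∧ ∀ u ∈ B, ∃ bu : Ballot Val, ⟨M, .prep bu⟩ ∈ rc u ∧ b.CoveredBy bu

/-- The handlers of concrete consensus and of bunched voting at node `v`, where `S` is the view
of `v`. -/
inductive Local (S : FBQS V) (v : V) (rc : V → Set (CMsg Val)) (n : Node Val) :
    List (CEvent V Val) → Option (CMsg Val) → Node Val → Prop
  /-- Invocation `propose(x)`, once per node. -/
  | propose (x : Val) (hp : n.cons.proposed = false) :
      Local S v rc n
        [.hist (.propose v x), .prepare v (Ballot.mk 1 x)]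
        (n.bv.prepare (Ballot.mk 1 x)).2
        { cons := { n.cons with cand := Ballot.mk 1 x, proposed := true }
          bv := (n.bv.prepare (Ballot.mk 1 x)).1 }
  | readyPrepQuorum (b : Ballot Val)
      (h : IsGreatest {b | n.bv.maxReadiedPrep < b ∧ QuorumPrep S v rc .vote b} b) :
      Local S v rc n [] (some ⟨.ready, .prep b⟩)
        { n with bv := { n.bv with maxReadiedPrep := b } }
  | readyPrepBlocking (b : Ballot Val)
      (h : IsGreatest {b | n.bv.maxReadiedPrep < b ∧ BlockingPrep S v rc .ready b} b) :
      Local S v rc n [] (some ⟨.ready, .prep b⟩)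
        { n with bv := { n.bv with maxReadiedPrep := b } }
  | deliverPrep (b : Ballot Val)
      (h : IsGreatest {b | n.bv.maxDeliveredPrep < b ∧ QuorumPrep S v rc .ready b} b)
      (es : List (CEvent V Val)) (o : Option (CMsg Val)) (n' : Node Val)
      (hn : Node.onPrepared v { n with bv := { n.bv with maxDeliveredPrep := b } } b =
        (es, o, n')) :
      Local S v rc n (.prepared v b :: es) o n'
  | readyCmtQuorum (b : Ballot Val) (hb : b ∉ n.bv.readiedCmt) (U : Set V) (hU : S.IsQuorum U)
      (hv : v ∈ U) (h : ∀ u ∈ U, ⟨.vote, .cmt b⟩ ∈ rc u) :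
      Local S v rc n [] (some ⟨.ready, .cmt b⟩)
        { n with bv := { n.bv with readiedCmt := insert b n.bv.readiedCmt } }
  | readyCmtBlocking (b : Ballot Val) (hb : b ∉ n.bv.readiedCmt) (B : Set V)
      (hB : S.IsBlocking v B) (h : ∀ u ∈ B, ⟨.ready, .cmt b⟩ ∈ rc u) :
      Local S v rc n [] (some ⟨.ready, .cmt b⟩)
        { n with bv := { n.bv with readiedCmt := insert b n.bv.readiedCmt } }
  | deliverCmt (b : Ballot Val) (hb : b ∉ n.bv.deliveredCmt) (U : Set V) (hU : S.IsQuorum U)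
      (hv : v ∈ U) (h : ∀ u ∈ U, ⟨.ready, .cmt b⟩ ∈ rc u)
      (es : List (CEvent V Val)) (n' : Node Val)
      (hn : Node.onCommitted v
        { n with bv := { n.bv with deliveredCmt := insert b n.bv.deliveredCmt } } b = (es, n')) :
      Local S v rc n (.committed v b :: es) none n'
  /-- Updating the round and starting the timer. -/
  | round (U : Set V) (bu : V → Ballot Val) (r : ℕ) (hU : S.IsQuorum U) (hv : v ∈ U)
      (h : ∀ u ∈ U, n.cons.round < (bu u).round ∧
        ∃ M : MsgKind, ⟨M, .cmt (bu u)⟩ ∈ rc u ∨ ⟨M, .prep (bu u)⟩ ∈ rc u)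
      (hr : IsLeast ((fun u => (bu u).round) '' U) r) :
      Local S v rc n [.startTimer v r] none
        { n with cons := { n.cons with round := r, timer := true } }
  /-- The timer expires. -/
  | timeout (ht : n.cons.timer = true) :
      Local S v rc n
        [.timeout v, .prepare v n.cons.nextCand]
        (n.bv.prepare n.cons.nextCand).2
        { cons := { n.cons with cand := n.cons.nextCand, timer := false }
          bv := (n.bv.prepare n.cons.nextCand).1 }

end

/-- Executions of the concrete protocol over a subjective FBQS: each correct node uses the quorums
and blocking sets of its own view, and nodes exchange single messages. -/
abbrev Exec [Fintype V] [DecidableEq V] (Val : Type*) [LinearOrder Val] {ok : Set V}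
    (F : SubjectiveFBQS ok) :=
  Execution (V := V) (Node.init Val)
    (NetStep ok (fun n => n.cons.stopped) (fun v => Local (F.view v) (v : V))
      CEvent.send CEvent.receive)

end CSCP

/-! The abstract execution does not imitate the concrete one message by message; it only has to
reproduce the proposals and decisions of the nodes in `I`. Three facts about the concrete execution
suffice. Each step triggers at most one such event. A proposing node has neither proposed nor
stopped, and a deciding node has not stopped (`CSCP.hist_cases`). All decisions in `I` have one
value `z` (`CSCP.agreement`). A ready message for committing `b` at an intact node goes back to a
quorum whose intact members voted for it. From then on no intact node can be the first to send a
ready message that aborts `b`, because two such quorums share an intact node. When `z` is decided,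
it is supported by the proposals made so far (`CSCP.valid`). Let the intact nodes that proposed at
least `z` and all nodes outside `I` vote for aborting the ballots below `⟨1, z⟩`, and let the faulty
nodes also send ready messages for that. Then quorums and blocking sets let every intact node send
these ready messages. This works because a ballot that covers `b` has at least the value of `b`, so
values only decrease along a chain of messages, and because a proposal of `x ≥ z` votes `false` for
everything below `⟨1, z⟩`.

The abstract execution copies the proposals of `I` and idles otherwise. Just before the first
decision it inserts a finite run that is invisible in `I` (`ASCP.silent_deliver`). The correct nodes
outside `I` propose `z`, the faulty nodes help, and support turns into actual ready messages. Then
the intact nodes, in lockstep, prepare `⟨1, z⟩`, enter round 1, time out to the candidate `⟨2, z⟩`,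
prepare and commit it, and deliver `true` for it. Round 2 is needed because nodes that proposed more
than `z` have already voted `false` for `⟨1, z⟩`, whereas no correct node has voted on `⟨2, z⟩`.
Afterwards every intact node can decide `z` at any time and can still propose if it has not done so,
so the rest of the history is copied event by event. -/

/-! ## Concatenations of sequences of lists -/

namespace Trace

variable {E E' : Type*}

theorem upTo_succ (ℓ : ℕ → List E) (n : ℕ) : upTo ℓ (n + 1) = upTo ℓ n ++ ℓ n := by
  simp [upTo, List.range_succ]

theorem upTo_prefix (ℓ : ℕ → List E) {n m : ℕ} (h : n ≤ m) : upTo ℓ n <+: upTo ℓ m := by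
  induction h with
  | refl => exact List.prefix_refl _
  | step _ ih => exact ih.trans (by rw [upTo_succ]; exact List.prefix_append _ _)

theorem getElem?_of_prefix {l l' : List E} (h : l <+: l') {k : ℕ} (hk : k < l.length) :
    l'[k]? = l[k]? := by
  obtain ⟨t, rfl⟩ := h
  exact List.getElem?_append_left hk

theorem concat_eq_getElem? (ℓ : ℕ → List E) {n k : ℕ} (hk : k < (upTo ℓ n).length) :
    concat ℓ k = (upTo ℓ n)[k]? := by
  classical
  have h : ∃ n, k < (upTo ℓ n).length := ⟨n, hk⟩
  have h' := Nat.find_spec h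
  unfold concat
  rw [dif_pos h]
  convert (getElem?_of_prefix (upTo_prefix ℓ (Nat.find_min' h hk)) h').symm using 3

theorem concat_eq_some_iff (ℓ : ℕ → List E) (k : ℕ) (e : E) :
    concat ℓ k = some e ↔ ∃ n, (upTo ℓ n)[k]? = some e := by
  classical
  constructor
  · intro h
    by_cases hk : ∃ n, k < (upTo ℓ n).length
    · obtain ⟨n, hn⟩ := hk
      exact ⟨n, by rw [← concat_eq_getElem? ℓ hn, h]⟩
    · rw [concat, dif_neg hk] at h
      cases h
  · rintro ⟨n, hn⟩
    rw [concat_eq_getElem? ℓ (List.getElem?_eq_some_iff.1 hn).1, hn]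

theorem concat_le {ℓ ℓ' : ℕ → List E} (h : ∀ n, ∃ m, upTo ℓ n <+: upTo ℓ' m) {k : ℕ} {e : E}
    (he : concat ℓ k = some e) : concat ℓ' k = some e := by
  obtain ⟨n, hn⟩ := (concat_eq_some_iff ℓ k e).1 he
  obtain ⟨m, hm⟩ := h n
  refine (concat_eq_some_iff ℓ' k e).2 ⟨m, ?_⟩
  rw [getElem?_of_prefix hm (List.getElem?_eq_some_iff.1 hn).1, hn]

/-- An entry of a concatenation is already an entry of some finite part, so mutual domination of the
finite parts by prefixes is enough, however the blocks are cut. -/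
theorem concat_congr {ℓ ℓ' : ℕ → List E} (h : ∀ n, ∃ m, upTo ℓ n <+: upTo ℓ' m)
    (h' : ∀ n, ∃ m, upTo ℓ' n <+: upTo ℓ m) : concat ℓ = concat ℓ' := by
  funext k
  ext e
  exact ⟨concat_le h, concat_le h'⟩

/-- Recutting a concatenation into blocks of at most one entry changes nothing; this is what lets
`filterMap`, which works entry by entry, be computed block by block in `filterMap_concat`. -/
theorem upTo_concat_eq_take (ℓ : ℕ → List E) (m : ℕ) :
    ∀ n ≤ (upTo ℓ m).length, upTo (fun k => (concat ℓ k).toList) n = (upTo ℓ m).take n := by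
  intro n
  induction n with
  | zero => intro _; simp [upTo]
  | succ n ih =>
    intro hn
    rw [upTo_succ, ih (by omega), concat_eq_getElem? ℓ (n := m) (by omega), List.take_add_one]

theorem upTo_concat_prefix (ℓ : ℕ → List E) (n : ℕ) :
    ∃ m, upTo (fun k => (concat ℓ k).toList) n <+: upTo ℓ m := by
  induction n with
  | zero => exact ⟨0, by simp [upTo]⟩
  | succ n ih =>
    rcases h : concat ℓ n with _ | e
    · rw [upTo_succ, h]
      simpa using ih
    · obtain ⟨m, hm⟩ := (concat_eq_some_iff ℓ n e).1 h
      refine ⟨m, ?_⟩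
      rw [upTo_concat_eq_take ℓ m (n + 1) (List.getElem?_eq_some_iff.1 hm).1]
      exact List.take_prefix _ _

theorem upTo_filterMap (f : E → Option E') (ℓ : ℕ → List E) (n : ℕ) :
    upTo (fun k => (ℓ k).filterMap f) n = (upTo ℓ n).filterMap f := by
  induction n with
  | zero => simp [upTo]
  | succ n ih => rw [upTo_succ, upTo_succ, ih, List.filterMap_append]

theorem filterMap_concat (f : E → Option E') (ℓ : ℕ → List E) :
    filterMap f (concat ℓ) = concat fun k => (ℓ k).filterMap f := by
  refine concat_congr (fun n => ?_) (fun n => ?_)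
  · obtain ⟨m, hm⟩ := upTo_concat_prefix ℓ n
    refine ⟨m, ?_⟩
    rw [upTo_filterMap f (fun k => (concat ℓ k).toList), upTo_filterMap]
    exact hm.filterMap f
  · refine ⟨(upTo ℓ n).length, ?_⟩
    rw [upTo_filterMap f (fun k => (concat ℓ k).toList), upTo_filterMap,
      upTo_concat_eq_take ℓ n _ le_rfl, List.take_length]

/-- The sequence of lists that starts with `l` and goes on with `ℓ`. -/
def cons (l : List E) (ℓ : ℕ → List E) : ℕ → List E
  | 0 => l
  | n + 1 => ℓ n

theorem upTo_cons (l : List E) (ℓ : ℕ → List E) (n : ℕ) :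
    upTo (cons l ℓ) (n + 1) = l ++ upTo ℓ n := by
  induction n with
  | zero => simp [upTo, cons]
  | succ n ih => rw [upTo_succ, ih, upTo_succ, List.append_assoc]; rfl

theorem concat_cons_eq_some_iff (l : List E) (ℓ : ℕ → List E) (k : ℕ) (e : E) :
    concat (cons l ℓ) k = some e ↔
      l[k]? = some e ∨ (l.length ≤ k ∧ concat ℓ (k - l.length) = some e) := by
  have h : concat (cons l ℓ) k = some e ↔ ∃ n, (l ++ upTo ℓ n)[k]? = some e := by
    rw [concat_eq_some_iff]
    constructor
    · rintro ⟨n, hn⟩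
      refine ⟨n, ?_⟩
      rw [← upTo_cons, getElem?_of_prefix (upTo_prefix _ (Nat.le_succ n))
        (List.getElem?_eq_some_iff.1 hn).1, hn]
    · rintro ⟨n, hn⟩
      exact ⟨n + 1, by rw [upTo_cons, hn]⟩
  rw [h, concat_eq_some_iff]
  rcases lt_or_ge k l.length with hk | hk
  · simp [List.getElem?_append_left hk, not_le.2 hk]
  · simp [List.getElem?_append_right hk, hk]

theorem concat_cons_congr (l : List E) {ℓ ℓ' : ℕ → List E} (h : concat ℓ = concat ℓ') :
    concat (cons l ℓ) = concat (cons l ℓ') := by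
  funext k
  ext e
  simp only [concat_cons_eq_some_iff, h]

theorem concat_cons_nil (ℓ : ℕ → List E) : concat (cons [] ℓ) = concat ℓ := by
  funext k
  ext e
  simp [concat_cons_eq_some_iff]

theorem cons_eq (ℓ : ℕ → List E) (n : ℕ) :
    cons (ℓ n) (fun k => ℓ (n + 1 + k)) = fun k => ℓ (n + k) := by
  funext k
  cases k with
  | zero => rfl
  | succ k => simp only [cons]; congr 1; omega

end Trace

/-! ## Runs with a given visible behaviour -/

section Produces

variable {C E H : Type*} (step : C → List E → C → Prop) (f : E → Option H)

/-- Some infinite run from `c` has the visible events `h 0 ++ h 1 ++ ⋯`. -/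
def Produces (c : C) (h : ℕ → List H) : Prop :=
  ∃ (cfg : ℕ → C) (ev : ℕ → List E), cfg 0 = c ∧ (∀ n, step (cfg n) (ev n) (cfg (n + 1))) ∧
    Trace.concat (fun k => (ev k).filterMap f) = Trace.concat h

/-- A finite run without visible events. -/
def Silent : C → C → Prop :=
  Relation.ReflTransGen fun c c' => ∃ e, step c e c' ∧ e.filterMap f = []

variable {step f}

theorem Produces.of_step {c c' : C} {e : List E} {h : ℕ → List H} (hs : step c e c')
    (hp : Produces step f c' h) : Produces step f c (Trace.cons (e.filterMap f) h) := by
  obtain ⟨cfg, ev, h0, hstep, hh⟩ := hp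
  refine ⟨fun n => Nat.casesOn n c cfg, Trace.cons e ev, rfl, ?_, ?_⟩
  · rintro (_ | n)
    · subst h0; exact hs
    · exact hstep n
  · rw [← Trace.concat_cons_congr _ hh]
    congr 1
    funext k
    cases k <;> rfl

theorem Produces.congr {c : C} {h h' : ℕ → List H} (hp : Produces step f c h)
    (hh : Trace.concat h = Trace.concat h') : Produces step f c h' := by
  obtain ⟨cfg, ev, h0, hstep, hh'⟩ := hp
  exact ⟨cfg, ev, h0, hstep, hh'.trans hh⟩

/-- Silent steps contribute empty blocks, which vanish in the concatenation. This is how a long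
preparation can be inserted before a single visible event. -/
theorem Produces.of_silent {c c' : C} {h : ℕ → List H} (hs : Silent step f c c')
    (hp : Produces step f c' h) : Produces step f c h := by
  induction hs using Relation.ReflTransGen.head_induction_on with
  | refl => exact hp
  | head hab _ ih =>
    obtain ⟨e, he, hn⟩ := hab
    refine (ih.of_step he).congr ?_
    rw [hn, Trace.concat_cons_nil]

/-- The form of simulation used here: `R n` relates the abstract configuration to the `n`-th
concrete one, and each concrete step is answered by exactly one step, possibly idle. -/
theorem Produces.of_invariant {R : ℕ → C → Prop} {c : C} {h : ℕ → List H} (h0 : R 0 c)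
    (hR : ∀ n c, R n c → ∃ e c', step c e c' ∧ e.filterMap f = h n ∧ R (n + 1) c') :
    Produces step f c h := by
  choose! e c' hs he hc' using hR
  let cfg : ℕ → C := fun n => Nat.rec c (fun n d => c' n d) n
  have hcfg : ∀ n, R n (cfg n) := by
    intro n
    induction n with
    | zero => exact h0
    | succ n ih => exact hc' n _ ih
  refine ⟨cfg, fun n => e n (cfg n), rfl, fun n => hs n _ (hcfg n), ?_⟩
  congr 1
  funext n
  exact he n _ (hcfg n)

/-- The invariant may change at time `T`, which will be the first decision. -/
theorem Produces.of_invariant_until {R : ℕ → C → Prop} {c : C} {h : ℕ → List H} (T : ℕ)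
    (h0 : R 0 c)
    (hR : ∀ n < T, ∀ c, R n c → ∃ e c', step c e c' ∧ e.filterMap f = h n ∧ R (n + 1) c')
    (hT : ∀ c, R T c → Produces step f c (fun k => h (T + k))) :
    Produces step f c h := by
  -- Backward induction: `j` counts the steps that remain until `T`.
  have key : ∀ j ≤ T, ∀ c, R (T - j) c → Produces step f c (fun k => h (T - j + k)) := by
    intro j
    induction j with
    | zero => intro _; simpa using hT
    | succ j ih =>
      intro hj c hc
      obtain ⟨e, c', hs, he, hc'⟩ := hR (T - (j + 1)) (by omega) c hc
      have hjj : T - (j + 1) + 1 = T - j := by omega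
      rw [hjj] at hc'
      have := (ih (by omega) c' hc').of_step hs
      rw [he, ← hjj, Trace.cons_eq] at this
      exact this
  simpa using key T le_rfl c (by simpa using h0)

end Produces

/-! ## Ballots -/

namespace Ballot

variable {Val : Type*}

@[simp] theorem val_bot : (⊥ : Ballot Val).val = none := rfl

@[simp] theorem val_mk (n : ℕ+) (x : Val) : (mk n x).val = some x := rfl

@[simp] theorem round_bot : (⊥ : Ballot Val).round = 0 := rfl

@[simp] theorem round_mk (n : ℕ+) (x : Val) : (mk n x).round = n := rfl

theorem eq_bot_or_mk (b : Ballot Val) : b = ⊥ ∨ ∃ n x, b = mk n x := by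
  induction b using WithBot.recBotCoe with
  | bot => exact Or.inl rfl
  | coe p => exact Or.inr ⟨(ofLex p).1, (ofLex p).2, rfl⟩

theorem exists_mk_of_val {b : Ballot Val} {x : Val} (h : b.val = some x) : ∃ n, b = mk n x := by
  rcases eq_bot_or_mk b with rfl | ⟨n, y, rfl⟩
  · simp at h
  · simp only [val_mk, Option.some.injEq] at h
    exact ⟨n, by rw [h]⟩

variable [LinearOrder Val]

theorem bot_lt_mk (n : ℕ+) (x : Val) : ⊥ < mk n x := WithBot.bot_lt_coe _

theorem mk_lt_mk {n m : ℕ+} {x y : Val} : mk n x < mk m y ↔ n < m ∨ n = m ∧ x < y := by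
  unfold mk
  rw [WithBot.coe_lt_coe, Prod.Lex.toLex_lt_toLex]

theorem lt_of_round_lt {b c : Ballot Val} (h : b.round < c.round) : b < c := by
  rcases eq_bot_or_mk c with rfl | ⟨m, y, rfl⟩
  · simp at h
  · rcases eq_bot_or_mk b with rfl | ⟨n, x, rfl⟩
    · exact bot_lt_mk _ _
    · exact mk_lt_mk.2 (Or.inl h)

/-- In round 1 a smaller ballot always has a different value. Preparing `⟨1, x⟩` therefore aborts
the whole interval below it, which both endorsement and the comparison of different proposals rely
on. -/
theorem lic_mk_one_iff {b : Ballot Val} {x : Val} : b.Lic (mk 1 x) ↔ b < mk 1 x := by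
  refine ⟨And.left, fun h => ⟨h, ?_⟩⟩
  rcases eq_bot_or_mk b with rfl | ⟨n, y, rfl⟩
  · simp
  · rcases mk_lt_mk.1 h with h | ⟨_, h⟩
    · exact absurd h (one_le (a := n)).not_gt
    · simpa using h.ne

/-- A ballot has at most the value of the ballots that cover it. -/
theorem CoveredBy.exists_val_le {b c : Ballot Val} (h : b.CoveredBy c) {x : Val}
    (hx : b.val = some x) : ∃ y, c.val = some y ∧ x ≤ y := by
  obtain ⟨n, rfl⟩ := exists_mk_of_val hx
  -- The null ballot is below and incompatible with every other ballot, so it cannot itself cover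
  -- one.
  have h0 : (⊥ : Ballot Val).Lic (mk n x) := ⟨bot_lt_mk _ _, by simp⟩
  rcases eq_bot_or_mk c with rfl | ⟨m, y, rfl⟩
  · exact absurd (h _ h0).1 (lt_irrefl _)
  · refine ⟨y, rfl, ?_⟩
    by_contra! hy
    -- If `y < x`, then `⟨1, y⟩` has to be aborted for `b`, but it is compatible with `c`, which has
    -- the same value `y`.
    have : (mk 1 y).Lic (mk n x) := by
      refine ⟨mk_lt_mk.2 ?_, by simpa using hy.ne⟩
      rcases (one_le (a := n)).lt_or_eq with h1 | h1
      · exact Or.inl h1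
      · exact Or.inr ⟨h1, hy⟩
    exact (h _ this).2 rfl

end Ballot

namespace Consensus

variable {Val : Type*} [LinearOrder Val]

theorem val_nextCand (c : Consensus Val) :
    c.nextCand.val = (if c.prepared = ⊥ then c.cand else c.prepared).val := by
  unfold nextCand
  rcases h : (if c.prepared = ⊥ then c.cand else c.prepared).val with _ | x <;> rfl

theorem round_nextCand (c : Consensus Val) : c.nextCand = ⊥ ∨ c.nextCand.round = c.round + 1 := by
  unfold nextCand
  rcases h : (if c.prepared = ⊥ then c.cand else c.prepared).val with _ | x
  · exact Or.inl rfl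
  · exact Or.inr rfl

end Consensus

/-! ## Invariants of single nodes of the concrete protocol -/

namespace CSCP

variable {V Val : Type*} [LinearOrder Val]

/-- The messages in `s` include a ready message that aborts `b`. -/
def ReadyAbove (s : Set (CMsg Val)) (b : Ballot Val) : Prop :=
  ∃ b', ⟨.ready, .prep b'⟩ ∈ s ∧ b.Lic b'

theorem ReadyAbove.mono {s t : Set (CMsg Val)} (h : s ⊆ t) {b : Ballot Val}
    (hb : ReadyAbove s b) : ReadyAbove t b := by
  obtain ⟨b', h', hl⟩ := hb
  exact ⟨b', h h', hl⟩

/-- Invariants that relate the state of a correct node with the messages that it has sent. -/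
structure Node.Inv (n : Node Val) (s : Set (CMsg Val)) : Prop where
  vote_prep_le : ∀ b, ⟨.vote, .prep b⟩ ∈ s → b ≤ n.bv.maxVotedPrep
  vote_cmt_le : ∀ b, ⟨.vote, .cmt b⟩ ∈ s →
    ⊥ < b ∧ b ≤ n.bv.maxVotedPrep ∧ b ≤ n.cons.prepared
  prepared_above : ∀ b : Ballot Val, b.Lic n.cons.prepared → ReadyAbove s b
  vote_cmt_above : ∀ c, ⟨.vote, .cmt c⟩ ∈ s → ∀ b : Ballot Val, b.Lic c → ReadyAbove s b
  vote_prep_above : ∀ c, ⟨.vote, .prep c⟩ ∈ s → ∀ b, ⟨.vote, .cmt b⟩ ∈ s → b.Lic c →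
    ReadyAbove s b
  voted_round : n.bv.maxVotedPrep = ⊥ ∨ n.cons.proposed = true ∨ 2 ≤ n.bv.maxVotedPrep.round
  timer_round : n.cons.timer = true → 1 ≤ n.cons.round

theorem Node.inv_init : (Node.init Val).Inv ∅ where
  vote_prep_le := by simp
  vote_cmt_le := by simp
  prepared_above b h := absurd h.1 (by simp [Node.init, Consensus.init])
  vote_cmt_above := by simp
  vote_prep_above := by simp
  voted_round := Or.inl rfl
  timer_round := by simp [Node.init, Consensus.init]

/-- A change that affects neither the fields of the invariants nor the votes. -/
theorem Node.Inv.of_ready {n n' : Node Val} {s : Set (CMsg Val)} {st : Stmt Val} (h : n.Inv s)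
    (hc : n'.cons = n.cons) (hb : n'.bv.maxVotedPrep = n.bv.maxVotedPrep) :
    n'.Inv (s ∪ {m | some (⟨.ready, st⟩ : CMsg Val) = some m}) := by
  have hs : s ⊆ s ∪ {m | some (⟨.ready, st⟩ : CMsg Val) = some m} := Set.subset_union_left
  have hv : ∀ t : Stmt Val, ⟨.vote, t⟩ ∈ s ∪ {m | some (⟨.ready, st⟩ : CMsg Val) = some m} →
      ⟨.vote, t⟩ ∈ s := by
    intro t ht
    simpa using ht
  constructor
  · intro b hm; rw [hb]; exact h.vote_prep_le b (hv _ hm)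
  · intro b hm; rw [hb, hc]; exact h.vote_cmt_le b (hv _ hm)
  · intro b hm; rw [hc] at hm; exact (h.prepared_above b hm).mono hs
  · intro c hm b hl; exact (h.vote_cmt_above c (hv _ hm) b hl).mono hs
  · intro c hm b hm' hl; exact (h.vote_prep_above c (hv _ hm) b (hv _ hm') hl).mono hs
  · rw [hb, hc]; exact h.voted_round
  · rw [hc]; exact h.timer_round

/-- A change without a message. -/
theorem Node.Inv.of_quiet {n n' : Node Val} {s : Set (CMsg Val)} (h : n.Inv s)
    (hp : n'.cons.prepared = n.cons.prepared) (ho : n'.cons.proposed = n.cons.proposed)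
    (hb : n'.bv.maxVotedPrep = n.bv.maxVotedPrep)
    (ht : n'.cons.timer = true → 1 ≤ n'.cons.round) :
    n'.Inv (s ∪ {m | none = some m}) := by
  have hs : s ∪ {m : CMsg Val | none = some m} = s := by simp
  rw [hs]
  constructor
  · intro b hm; rw [hb]; exact h.vote_prep_le b hm
  · intro b hm; rw [hb, hp]; exact h.vote_cmt_le b hm
  · intro b hm; rw [hp] at hm; exact h.prepared_above b hm
  · exact h.vote_cmt_above
  · exact h.vote_prep_above
  · rw [hb, ho]; exact h.voted_round
  · exact ht

/-- Preparing a ballot, as a proposal or after a timeout. -/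
theorem Node.Inv.of_prepare {n n' : Node Val} {s : Set (CMsg Val)} (h : n.Inv s) (b : Ballot Val)
    (hp : n'.cons.prepared = n.cons.prepared)
    (hb : n'.bv = (n.bv.prepare b).1)
    (hr : n.bv.maxVotedPrep < b → n'.cons.proposed = true ∨ 2 ≤ b.round)
    (ho : n.cons.proposed = true → n'.cons.proposed = true)
    (ht : n'.cons.timer = true → 1 ≤ n'.cons.round)
    (hv : n.bv.maxVotedPrep < b → ∀ c, ⟨.vote, .cmt c⟩ ∈ s → c.Lic b → c.Lic n.cons.prepared) :
    n'.Inv (s ∪ {m | (n.bv.prepare b).2 = some m}) := by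
  by_cases hlt : n.bv.maxVotedPrep < b
  · have hs : s ⊆ s ∪ {m | (n.bv.prepare b).2 = some m} := Set.subset_union_left
    have hc : ∀ c : Ballot Val, ⟨.vote, .cmt c⟩ ∈ s ∪ {m | (n.bv.prepare b).2 = some m} →
        ⟨.vote, .cmt c⟩ ∈ s := by
      intro c hc
      simpa [BV.prepare, hlt] using hc
    have hq : ∀ c : Ballot Val, ⟨.vote, .prep c⟩ ∈ s ∪ {m | (n.bv.prepare b).2 = some m} →
        ⟨.vote, .prep c⟩ ∈ s ∨ c = b := by
      intro c hc
      simpa [BV.prepare, hlt, eq_comm, or_comm] using hc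
    have hb' : n'.bv.maxVotedPrep = b := by rw [hb]; simp [BV.prepare, hlt]
    constructor
    · intro c hm
      rw [hb']
      rcases hq c hm with hm | rfl
      · exact (h.vote_prep_le c hm).trans hlt.le
      · exact le_rfl
    · intro c hm
      rw [hb', hp]
      obtain ⟨h1, h2, h3⟩ := h.vote_cmt_le c (hc c hm)
      exact ⟨h1, h2.trans hlt.le, h3⟩
    · intro c hm; rw [hp] at hm; exact (h.prepared_above c hm).mono hs
    · intro c hm b' hl; exact (h.vote_cmt_above c (hc c hm) b' hl).mono hs
    · intro c hm c' hm' hl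
      rcases hq c hm with hm | rfl
      · exact (h.vote_prep_above c hm c' (hc c' hm') hl).mono hs
      -- The new vote is for `c`; an earlier committed vote incompatible with it lies incompatibly
      -- below the prepared ballot, for which the node has already been ready.
      · exact (h.prepared_above c' (hv hlt c' (hc c' hm') hl)).mono hs
    · rw [hb']; exact Or.inr (hr hlt)
    · exact ht
  · have h2 : (n.bv.prepare b).2 = none := by simp [BV.prepare, hlt]
    have h1 : (n.bv.prepare b).1 = n.bv := by simp [BV.prepare, hlt]
    rw [h1] at hb
    have hs : s ∪ {m : CMsg Val | none = some m} = s := by simp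
    rw [h2, hs]
    constructor
    · intro b hm; rw [hb]; exact h.vote_prep_le b hm
    · intro b hm; rw [hb, hp]; exact h.vote_cmt_le b hm
    · intro b hm; rw [hp] at hm; exact h.prepared_above b hm
    · exact h.vote_cmt_above
    · exact h.vote_prep_above
    · rw [hb]
      rcases h.voted_round with h | h | h
      · exact Or.inl h
      · exact Or.inr (Or.inl (ho h))
      · exact Or.inr (Or.inr h)
    · exact ht

/-- A quorum of ready messages includes one of the node itself. -/
theorem QuorumPrep.readyAbove {S : FBQS V} {v : V} {rc : V → Set (CMsg Val)} {b c : Ballot Val}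
    (h : QuorumPrep S v rc .ready c) (hl : b.Lic c) : ReadyAbove (rc v) b := by
  obtain ⟨U, _, hv, hU⟩ := h
  obtain ⟨bu, hm, hcov⟩ := hU v hv
  exact ⟨bu, hm, hcov b hl⟩

/-- Two mechanisms keep the invariant. A quorum of ready messages for preparing a ballot contains
the node itself, so the node has sent a covering ready message before it prepares or commits. And a
candidate after a timeout takes the value of the prepared ballot, so whatever it contradicts among
the node's votes for committing is already contradicted by the prepared ballot. -/
theorem Local.inv {S : FBQS V} {v : V} {rc : V → Set (CMsg Val)} {n n' : Node Val}
    {es : List (CEvent V Val)} {o : Option (CMsg Val)} {s : Set (CMsg Val)}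
    (hl : Local S v rc n es o n') (hrc : rc v ⊆ s) (h : n.Inv s) :
    n'.Inv (s ∪ {m | o = some m}) := by
  cases hl with
  | propose x hp =>
    refine h.of_prepare _ rfl rfl (fun _ => Or.inl rfl) (fun _ => rfl) h.timer_round ?_
    -- A node may time out before it proposes, but then its voted ballot has round at least 2 and a
    -- round-1 proposal is not above it. So the proposal is effective only when nothing has been
    -- voted, and there is no vote for committing.
    intro hlt c hc _
    exfalso
    obtain ⟨h1, h2, _⟩ := h.vote_cmt_le c hc
    rcases h.voted_round with h0 | h0 | h0
    · rw [h0] at h2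
      exact absurd (h1.trans_le h2) (lt_irrefl _)
    · simp [hp] at h0
    · refine absurd hlt (not_lt.2 (Ballot.lt_of_round_lt ?_).le)
      simp only [Ballot.round_mk, PNat.one_coe]
      omega
  | readyPrepQuorum b hb => exact h.of_ready rfl rfl
  | readyPrepBlocking b hb => exact h.of_ready rfl rfl
  | deliverPrep b hb es o n' hn =>
    have hq := hb.1.2
    unfold Node.onPrepared at hn
    by_cases h1 : n.cons.prepared < b
    · simp only [h1, if_true] at hn
      by_cases h2 : n.cons.cand ≤ b
      · simp only [h2, if_true, Prod.mk.injEq] at hn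
        obtain ⟨rfl, rfl, rfl⟩ := hn
        unfold BV.commit
        have habove : ∀ b' : Ballot Val, b'.Lic b → ReadyAbove s b' :=
          fun b' hb' => (hq.readyAbove hb').mono hrc
        split_ifs with h3
        · have h4 : n.bv.maxVotedPrep = b := h3.2
          have hs : s ⊆ s ∪ {m | some (⟨.vote, .cmt b⟩ : CMsg Val) = some m} :=
            Set.subset_union_left
          have hc : ∀ c : Ballot Val,
              ⟨.vote, .cmt c⟩ ∈ s ∪ {m | some (⟨.vote, .cmt b⟩ : CMsg Val) = some m} →
              ⟨.vote, .cmt c⟩ ∈ s ∨ c = b := by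
            intro c hc
            simpa [eq_comm, or_comm] using hc
          have hp : ∀ c : Ballot Val,
              ⟨.vote, .prep c⟩ ∈ s ∪ {m | some (⟨.vote, .cmt b⟩ : CMsg Val) = some m} →
              ⟨.vote, .prep c⟩ ∈ s := by
            intro c hc
            simpa using hc
          constructor
          · intro c hm; exact h.vote_prep_le c (hp c hm)
          · intro c hm
            rcases hc c hm with hm | rfl
            · obtain ⟨g1, g2, g3⟩ := h.vote_cmt_le c hm
              exact ⟨g1, g2, g3.trans h1.le⟩
            · exact ⟨bot_le.trans_lt h1, h4.ge, le_rfl⟩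
          · intro c hl; exact (habove c hl).mono hs
          · intro c hm b' hl
            rcases hc c hm with hm | rfl
            · exact (h.vote_cmt_above c hm b' hl).mono hs
            · exact (habove b' hl).mono hs
          · intro c hm c' hm' hl
            rcases hc c' hm' with hm' | rfl
            · exact (h.vote_prep_above c (hp c hm) c' hm' hl).mono hs
            -- A vote for committing `b` requires that `b` is the highest ballot voted for
            -- preparing, so no earlier vote for preparing is above it.
            · have := h.vote_prep_le c (hp c hm)
              rw [h4] at this
              exact absurd hl.1 (not_lt.2 this)
          · exact h.voted_round
          · exact h.timer_round
        · have hs : s ∪ {m : CMsg Val | False} = s := by simp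
          change Node.Inv _ (s ∪ {m : CMsg Val | False})
          rw [hs]
          refine ⟨h.vote_prep_le, ?_, habove, h.vote_cmt_above, h.vote_prep_above,
            h.voted_round, h.timer_round⟩
          intro c hm
          obtain ⟨g1, g2, g3⟩ := h.vote_cmt_le c hm
          exact ⟨g1, g2, g3.trans h1.le⟩
      · simp only [h2, if_false, Prod.mk.injEq] at hn
        obtain ⟨rfl, rfl, rfl⟩ := hn
        have hs : s ∪ {m : CMsg Val | none = some m} = s := by simp
        rw [hs]
        refine ⟨h.vote_prep_le, ?_, fun b' hb' => (hq.readyAbove hb').mono hrc, h.vote_cmt_above,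
          h.vote_prep_above, h.voted_round, h.timer_round⟩
        intro c hm
        obtain ⟨g1, g2, g3⟩ := h.vote_cmt_le c hm
        exact ⟨g1, g2, g3.trans h1.le⟩
    · simp only [h1, if_false, Prod.mk.injEq] at hn
      obtain ⟨rfl, rfl, rfl⟩ := hn
      exact h.of_quiet rfl rfl rfl h.timer_round
  | readyCmtQuorum b hb U hU hv hm => exact h.of_ready rfl rfl
  | readyCmtBlocking b hb B hB hm => exact h.of_ready rfl rfl
  | deliverCmt b hb U hU hv hm es n' hn =>
    unfold Node.onCommitted at hn
    split at hn <;> simp only [Prod.mk.injEq] at hn <;> obtain ⟨rfl, rfl⟩ := hn <;>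
      exact h.of_quiet rfl rfl rfl h.timer_round
  | round U bu r hU hv hm hr =>
    refine h.of_quiet rfl rfl rfl fun _ => ?_
    obtain ⟨u, hu, rfl⟩ := hr.1
    exact Nat.one_le_of_lt (hm u hu).1
  | timeout ht =>
    refine h.of_prepare _ rfl rfl (fun hlt => Or.inr ?_) (fun hp => hp) (by simp) ?_
    · rcases n.cons.round_nextCand with h0 | h0
      · rw [h0] at hlt
        exact absurd hlt not_lt_bot
      · have := h.timer_round ht
        omega
    · intro _ c hc hl
      obtain ⟨h1, _, h3⟩ := h.vote_cmt_le c hc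
      -- Having voted for committing, the node has prepared a ballot, so the next candidate has the
      -- value of that ballot and not of the old candidate.
      have hne : n.cons.prepared ≠ ⊥ := (h1.trans_le h3).ne'
      have hval := hl.2
      rw [n.cons.val_nextCand, if_neg hne] at hval
      exact ⟨lt_of_le_of_ne h3 fun h => hval (by rw [h]), hval⟩

end CSCP

/-! ## Intact sets -/

namespace SubjectiveFBQS

variable {V : Type*} {ok : Set V} {F : SubjectiveFBQS ok} {I : Set V}

/-- Every node of `I` in `W` has a slice whose part in `I` is included in `W`. -/
def IsQuorumWithin (F : SubjectiveFBQS ok) (I W : Set V) : Prop :=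
  ∀ u (hu : u ∈ ok), u ∈ I → u ∈ W → ∃ q ∈ (F.view ⟨u, hu⟩).slices u, q ∩ I ⊆ W

theorem isQuorumWithin_of_isQuorum {v : ok} {U : Set V} (hU : (F.view v).IsQuorum U) :
    F.IsQuorumWithin I U := by
  intro u hu _ huU
  obtain ⟨q, hq, hqU⟩ := hU.2 u huU
  refine ⟨q, ?_, Set.inter_subset_left.trans hqU⟩
  rwa [F.agree _ v ⟨u, hu⟩]

/-- Views agree on the slices of intact nodes, so the parts in `I` of both sets are quorums of one
and the same projected system, where intertwinedness applies. Quorums of different views thus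
intersect inside `I`. -/
theorem IsIntact.inter_nonempty (hI : F.IsIntact I) {W W' : Set V} (hW : F.IsQuorumWithin I W)
    (hW' : F.IsQuorumWithin I W') {v v' : V} (hv : v ∈ I) (hvW : v ∈ W) (hv' : v' ∈ I)
    (hvW' : v' ∈ W') : ∃ u ∈ I, u ∈ W ∧ u ∈ W' := by
  have hvok := hI.2.1 hv
  have hquorum : ∀ {W : Set V} {v' : V}, F.IsQuorumWithin I W → v' ∈ I → v' ∈ W →
      ((F.view ⟨v, hvok⟩).proj I).IsQuorum (Subtype.val ⁻¹' W) := by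
    intro W v' hW hv' hvW'
    refine ⟨⟨⟨v', hv'⟩, hvW'⟩, ?_⟩
    rintro ⟨u, hu⟩ huW
    obtain ⟨q, hq, hqW⟩ := hW u (hI.2.1 hu) hu huW
    rw [F.agree _ ⟨v, hvok⟩ ⟨u, hI.2.1 hu⟩] at hq
    exact ⟨_, ⟨q, hq, rfl⟩, fun x hx => hqW ⟨hx, x.2⟩⟩
  obtain ⟨u, ⟨hu, hu'⟩, _⟩ := ((hI.2.2 ⟨v, hvok⟩ hv).2.2 ⟨v, hv⟩ ⟨v', hv'⟩).2.2 _ _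
    (hquorum hW hv hvW) (hquorum hW' hv' hvW') hvW hvW'
  exact ⟨u, u.2, hu, hu'⟩

/-- `I` is a quorum, so it includes a slice of `v`, which the blocking set must meet. Faulty nodes
alone can therefore never block an intact node. -/
theorem IsIntact.exists_mem_of_isBlocking (hI : F.IsIntact I) {v : ok} (hv : (v : V) ∈ I)
    {B : Set V} (hB : (F.view v).IsBlocking v B) : ∃ u ∈ I, u ∈ B := by
  obtain ⟨q, hq, hqI⟩ := (hI.2.2 v hv).2.1.2 v hv
  obtain ⟨u, huq, huB⟩ := hB q hq
  exact ⟨u, hqI huq, huB⟩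

theorem IsIntact.isQuorum (hI : F.IsIntact I) {v : ok} (hv : (v : V) ∈ I) :
    (F.view v).IsQuorum I := (hI.2.2 v hv).2.1

/-- The correct nodes that can send a ready message when the nodes in `P` and all nodes outside of
`I` vote for it, and the faulty nodes send ready messages for it. -/
inductive CanReady (F : SubjectiveFBQS ok) (I P : Set V) : V → Prop
  | quorum (v : ok) (U : Set V) (hU : (F.view v).IsQuorum U) (hv : (v : V) ∈ U)
      (h : U ∩ I ⊆ P) : CanReady F I P v
  | blocking (v : ok) (B : Set V) (hB : (F.view v).IsBlocking v B)
      (h : ∀ u ∈ B, u ∈ ok → CanReady F I P u) : CanReady F I P v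

theorem CanReady.mono {P P' : Set V} (hP : P ⊆ P') {v : V} (h : CanReady F I P v) :
    CanReady F I P' v := by
  induction h with
  | quorum v U hU hv h => exact .quorum v U hU hv (h.trans hP)
  | blocking v B hB _ ih => exact .blocking v B hB ih

/-- Ready messages cascade from the intact part of a quorum to all intact nodes. -/
theorem IsIntact.canReady_of_isQuorum (hI : F.IsIntact I) {P U : Set V} {v : ok}
    (hv : (v : V) ∈ I) (hU : (F.view v).IsQuorum U) (hvU : (v : V) ∈ U)
    (h : ∀ u ∈ U, u ∈ I → F.CanReady I P u) : ∀ u ∈ I, F.CanReady I P u := by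
  by_contra! hcon
  obtain ⟨w, hw, hwn⟩ := hcon
  -- A node that cannot become ready is not blocked by the ready and faulty nodes together, so it
  -- has a slice of correct nodes that cannot become ready either. Those nodes form a quorum within
  -- `I`, which would meet the ready part of `U`.
  obtain ⟨u, huI, huU, hun⟩ := hI.inter_nonempty (isQuorumWithin_of_isQuorum hU)
    (W' := {u | ¬ F.CanReady I P u}) (fun u hu huI hun => by
      have : ¬ (F.view ⟨u, hu⟩).IsBlocking u {x | x ∈ ok → F.CanReady I P x} :=
        fun hB => hun (.blocking ⟨u, hu⟩ _ hB fun x hx => hx)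
      simp only [FBQS.IsBlocking, not_forall, Set.not_nonempty_iff_eq_empty] at this
      obtain ⟨q, hq, hqe⟩ := this
      refine ⟨q, hq, fun x hx hxr => ?_⟩
      exact (hqe.subset ⟨hx.1, fun _ => hxr⟩ : x ∈ (∅ : Set V))) hv hvU hw hwn
  exact hun (h u huU huI)

end SubjectiveFBQS

/-! ## Executions of the concrete protocol -/

namespace CSCP

/-! ### What makes a node send a given message or trigger a given event. -/

section LocalInversion

variable {V Val : Type*} [LinearOrder Val] {S : FBQS V} {v : V} {rc : V → Set (CMsg Val)}
  {n n' : Node Val} {es : List (CEvent V Val)} {o : Option (CMsg Val)} {b : Ballot Val}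

theorem BV.prepare_snd (s : BV Val) (b : Ballot Val) :
    (s.prepare b).2 = none ∨ (s.prepare b).2 = some ⟨.vote, .prep b⟩ := by
  unfold BV.prepare
  split_ifs <;> simp

theorem BV.commit_snd (s : BV Val) (b : Ballot Val) :
    (s.commit b).2 = none ∨ s.maxVotedPrep = b ∧ (s.commit b).2 = some ⟨.vote, .cmt b⟩ := by
  unfold BV.commit
  split_ifs with h
  · exact Or.inr ⟨h.2, rfl⟩
  · exact Or.inl rfl

theorem Node.onPrepared_cases (v : V) (n : Node Val) (b : Ballot Val) :
    (Node.onPrepared v n b).1.filterMap CEvent.toHist = [] ∧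
    (∀ e ∈ (Node.onPrepared v n b).1, e.node = v) ∧
    (Node.onPrepared v n b).2.2.cons.proposed = n.cons.proposed ∧
    (Node.onPrepared v n b).2.2.cons.stopped = n.cons.stopped ∧
    ((Node.onPrepared v n b).2.1 = none ∨
      n.bv.maxVotedPrep = b ∧ (Node.onPrepared v n b).2.1 = some ⟨.vote, .cmt b⟩) ∧
    ((Node.onPrepared v n b).2.2.cons.cand = n.cons.cand ∨
      (Node.onPrepared v n b).2.2.cons.cand = b) ∧
    ((Node.onPrepared v n b).2.2.cons.prepared = n.cons.prepared ∨
      (Node.onPrepared v n b).2.2.cons.prepared = b) := by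
  unfold Node.onPrepared
  split_ifs
  · simpa [CEvent.toHist, CEvent.node] using n.bv.commit_snd b
  · simp
  · simp

theorem Local.of_ready_prep (h : Local S v rc n es o n') (ho : o = some ⟨.ready, .prep b⟩) :
    QuorumPrep S v rc .vote b ∨ BlockingPrep S v rc .ready b := by
  cases h with
  | readyPrepQuorum b' hb => cases ho; exact Or.inl hb.1.2
  | readyPrepBlocking b' hb => cases ho; exact Or.inr hb.1.2
  | propose x _ =>
    rcases n.bv.prepare_snd (Ballot.mk 1 x) with h | h <;> rw [h] at ho <;> simp at ho
  | timeout _ => rcases n.bv.prepare_snd n.cons.nextCand with h | h <;> rw [h] at ho <;> simp at ho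
  | deliverPrep b' _ es o n' hn =>
    have := (Node.onPrepared_cases v { n with bv := { n.bv with maxDeliveredPrep := b' } } b').2.2.2.2.1
    rw [hn] at this
    rcases this with h | ⟨_, h⟩ <;> simp [ho] at h
  | _ => simp at ho

theorem Local.of_ready_cmt (h : Local S v rc n es o n') (ho : o = some ⟨.ready, .cmt b⟩) :
    (∃ U, S.IsQuorum U ∧ v ∈ U ∧ ∀ u ∈ U, ⟨.vote, .cmt b⟩ ∈ rc u) ∨
      ∃ B, S.IsBlocking v B ∧ ∀ u ∈ B, ⟨.ready, .cmt b⟩ ∈ rc u := by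
  cases h with
  | readyCmtQuorum b' _ U hU hv h => cases ho; exact Or.inl ⟨U, hU, hv, h⟩
  | readyCmtBlocking b' _ B hB h => cases ho; exact Or.inr ⟨B, hB, h⟩
  | propose x _ =>
    rcases n.bv.prepare_snd (Ballot.mk 1 x) with h | h <;> rw [h] at ho <;> simp at ho
  | timeout _ => rcases n.bv.prepare_snd n.cons.nextCand with h | h <;> rw [h] at ho <;> simp at ho
  | deliverPrep b' _ es o n' hn =>
    have := (Node.onPrepared_cases v { n with bv := { n.bv with maxDeliveredPrep := b' } } b').2.2.2.2.1
    rw [hn] at this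
    rcases this with h | ⟨_, h⟩ <;> simp [ho] at h
  | _ => simp at ho

theorem Local.of_vote_cmt (h : Local S v rc n es o n') (ho : o = some ⟨.vote, .cmt b⟩) :
    n.bv.maxVotedPrep = b ∧ QuorumPrep S v rc .ready b := by
  cases h with
  | propose x _ =>
    rcases n.bv.prepare_snd (Ballot.mk 1 x) with h | h <;> rw [h] at ho <;> simp at ho
  | timeout _ => rcases n.bv.prepare_snd n.cons.nextCand with h | h <;> rw [h] at ho <;> simp at ho
  | deliverPrep b' hb es o n' hn =>
    have := (Node.onPrepared_cases v { n with bv := { n.bv with maxDeliveredPrep := b' } } b').2.2.2.2.1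
    rw [hn] at this
    rcases this with h | ⟨h', h⟩
    · simp [ho] at h
    · simp only [ho, Option.some.injEq, CMsg.mk.injEq, Stmt.cmt.injEq, true_and] at h
      subst h
      exact ⟨h', hb.1.2⟩
  | _ => simp at ho

theorem Local.of_vote_prep (h : Local S v rc n es o n') (ho : o = some ⟨.vote, .prep b⟩) :
    (∃ x, b = Ballot.mk 1 x ∧ .hist (.propose v x) ∈ es) ∨ b = n.cons.nextCand := by
  cases h with
  | propose x _ =>
    rcases n.bv.prepare_snd (Ballot.mk 1 x) with h | h <;> rw [h] at ho <;> simp at ho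
    exact Or.inl ⟨x, ho.symm, by simp⟩
  | timeout _ =>
    rcases n.bv.prepare_snd n.cons.nextCand with h | h <;> rw [h] at ho <;> simp at ho
    exact Or.inr ho.symm
  | deliverPrep b' hb es o n' hn =>
    have := (Node.onPrepared_cases v { n with bv := { n.bv with maxDeliveredPrep := b' } } b').2.2.2.2.1
    rw [hn] at this
    rcases this with h | ⟨h', h⟩ <;> simp [ho] at h
  | _ => simp at ho

/-- The value of the candidate comes from a proposal, the old candidate or a prepared ballot. -/
theorem Local.val_cand (h : Local S v rc n es o n') :
    (∃ x, n'.cons.cand.val = some x ∧ .hist (.propose v x) ∈ es) ∨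
      n'.cons.cand.val = n.cons.cand.val ∨ n'.cons.cand.val = n.cons.prepared.val ∨
      QuorumPrep S v rc .ready n'.cons.cand := by
  cases h with
  | propose x _ => exact Or.inl ⟨x, rfl, by simp⟩
  | timeout _ =>
    have := n.cons.val_nextCand
    split_ifs at this
    · exact Or.inr (Or.inl this)
    · exact Or.inr (Or.inr (Or.inl this))
  | deliverPrep b' hb es o n' hn =>
    have := (Node.onPrepared_cases v { n with bv := { n.bv with maxDeliveredPrep := b' } } b').2.2.2.2.2.1
    rw [hn] at this
    rcases this with h | h
    · exact Or.inr (Or.inl (by rw [h]))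
    · exact Or.inr (Or.inr (Or.inr (by rw [h]; exact hb.1.2)))
  | deliverCmt b hb U hU hv hm es n' hn =>
    unfold Node.onCommitted at hn
    split at hn <;> simp only [Prod.mk.injEq] at hn <;> obtain ⟨rfl, rfl⟩ := hn <;> simp
  | _ => exact Or.inr (Or.inl rfl)

theorem Local.prepared_eq (h : Local S v rc n es o n') :
    n'.cons.prepared = n.cons.prepared ∨ QuorumPrep S v rc .ready n'.cons.prepared := by
  cases h with
  | deliverPrep b' hb es o n' hn =>
    have := (Node.onPrepared_cases v { n with bv := { n.bv with maxDeliveredPrep := b' } } b').2.2.2.2.2.2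
    rw [hn] at this
    rcases this with h | h
    · exact Or.inl h
    · exact Or.inr (by rw [h]; exact hb.1.2)
  | deliverCmt b hb U hU hv hm es n' hn =>
    unfold Node.onCommitted at hn
    split at hn <;> simp only [Prod.mk.injEq] at hn <;> obtain ⟨rfl, rfl⟩ := hn <;> simp
  | _ => exact Or.inl rfl

theorem Local.node_eq (h : Local S v rc n es o n') : ∀ e ∈ es, e.node = v := by
  cases h with
  | deliverPrep b' hb es o n' hn =>
    have := (Node.onPrepared_cases v { n with bv := { n.bv with maxDeliveredPrep := b' } } b').2.1
    rw [hn] at this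
    simpa [CEvent.node] using this
  | deliverCmt b hb U hU hv hm es n' hn =>
    unfold Node.onCommitted at hn
    split at hn <;> simp only [Prod.mk.injEq] at hn <;> obtain ⟨rfl, rfl⟩ := hn <;>
      simp [CEvent.node, HistEvent.node]
  | _ => simp [CEvent.node, HistEvent.node]

/-- The events of the history that a handler triggers, and its effect on the fields that enable
these events. -/
theorem Local.hist_cases (h : Local S v rc n es o n') :
    (es.filterMap CEvent.toHist = [] ∧ n'.cons.proposed = n.cons.proposed ∧
      n'.cons.stopped = n.cons.stopped) ∨
    (∃ x, es.filterMap CEvent.toHist = [.propose v x] ∧ .hist (.propose v x) ∈ es ∧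
      n.cons.proposed = false ∧ n'.cons.proposed = true ∧ n'.cons.stopped = n.cons.stopped) ∨
    (∃ b z, es.filterMap CEvent.toHist = [.decide v z] ∧ b.val = some z ∧
      ⟨.ready, .cmt b⟩ ∈ rc v ∧ n'.cons.proposed = n.cons.proposed ∧
      n'.cons.stopped = true) := by
  cases h with
  | propose x hp => exact Or.inr (Or.inl ⟨x, by simp [CEvent.toHist, hp]⟩)
  | deliverPrep b' hb es o n' hn =>
    obtain ⟨h1, _, h2, h3, _⟩ :=
      Node.onPrepared_cases v { n with bv := { n.bv with maxDeliveredPrep := b' } } b'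
    rw [hn] at h1 h2 h3
    exact Or.inl ⟨by simpa [CEvent.toHist] using h1, h2, h3⟩
  | deliverCmt b hb U hU hv hm es n' hn =>
    unfold Node.onCommitted at hn
    split at hn
    all_goals
      rename_i hval
      obtain ⟨rfl, rfl⟩ := Prod.mk.inj hn
    · exact Or.inr (Or.inr ⟨b, _, rfl, hval, hm v hv, rfl, rfl⟩)
    · simp [CEvent.toHist]
  | _ => exact Or.inl (by simp [CEvent.toHist])

end LocalInversion

end CSCP

namespace CSCP

/-! ### Links, agreement and validity in executions of the concrete protocol. -/

section Global

variable {V : Type*} [Fintype V] [DecidableEq V] {Val : Type*} [LinearOrder Val] {ok : Set V}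
  {F : SubjectiveFBQS ok} {I : Set V} (X : Exec Val F)

/-- The effect of a step on a single node. -/
theorem step_cases (n : ℕ) (v : V) :
    ((X.cfg (n + 1)).node v = (X.cfg n).node v ∧ (X.cfg (n + 1)).sent v = (X.cfg n).sent v) ∨
    ∃ (hv : v ∈ ok) (es : List (CEvent V Val)) (o : Option (CMsg Val)),
      (∀ e ∈ es, e ∈ X.events n) ∧
      Local (F.view ⟨v, hv⟩) v ((X.cfg n).rcvd v) ((X.cfg n).node v) es o
        ((X.cfg (n + 1)).node v) ∧
      (X.cfg (n + 1)).sent v = (X.cfg n).sent v ∪ {m | o = some m} := by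
  have h := X.step n
  generalize X.cfg n = c, X.cfg (n + 1) = c', X.events n = es at h
  cases h with
  | act w es o n' hs h =>
    by_cases hvw : v = w
    · subst hvw
      refine Or.inr ⟨w.2, es, o, fun e he => List.mem_append_left _ he, ?_, ?_⟩
      · simpa using h
      · simp
    · exact Or.inl ⟨by simp [hvw], by simp [hvw]⟩
  | receive w u m hs hnew hsent => exact Or.inl ⟨rfl, rfl⟩
  | idle => exact Or.inl ⟨rfl, rfl⟩

theorem sent_subset_succ (n : ℕ) (v : V) : (X.cfg n).sent v ⊆ (X.cfg (n + 1)).sent v := by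
  rcases step_cases X n v with ⟨_, h⟩ | ⟨_, _, _, _, _, h⟩
  · exact h.ge
  · rw [h]
    exact Set.subset_union_left

theorem sent_mono {n m : ℕ} (h : n ≤ m) (v : V) : (X.cfg n).sent v ⊆ (X.cfg m).sent v :=
  monotone_nat_of_le_succ (f := fun n => (X.cfg n).sent v) (fun n => sent_subset_succ X n v) h

theorem rcvd_subset (n : ℕ) (v : V) {u : V} (hu : u ∈ ok) :
    (X.cfg n).rcvd v u ⊆ (X.cfg n).sent u := by
  induction n with
  | zero => simp [X.start]
  | succ n ih =>
    have hs := sent_subset_succ X n u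
    refine Set.Subset.trans ?_ (Set.union_subset (ih.trans hs) hs)
    have h := X.step n
    generalize X.cfg n = c, X.cfg (n + 1) = c', X.events n = es at h
    cases h with
    | act w es o n' _ h => exact Set.subset_union_left
    | idle => exact Set.subset_union_left
    | receive w u' m _ _ hsent =>
      intro x hx
      by_cases hvw : v = w
      · subst hvw
        by_cases huu : u = u'
        · subst huu
          simp only [Function.update_self, Set.mem_insert_iff] at hx
          rcases hx with rfl | hx
          · exact Or.inr (hsent hu)
          · exact Or.inl hx
        · left
          simpa [huu] using hx
      · left
        simpa [hvw] using hx

/-- A new message is sent by a handler. -/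
theorem mem_sent_succ {n : ℕ} {v : V} {m : CMsg Val} (h : m ∈ (X.cfg (n + 1)).sent v) :
    m ∈ (X.cfg n).sent v ∨
    ∃ (hv : v ∈ ok) (es : List (CEvent V Val)), (∀ e ∈ es, e ∈ X.events n) ∧
      Local (F.view ⟨v, hv⟩) v ((X.cfg n).rcvd v) ((X.cfg n).node v) es (some m)
        ((X.cfg (n + 1)).node v) := by
  rcases step_cases X n v with ⟨_, hs⟩ | ⟨hv, es, o, he, hl, hs⟩
  · exact Or.inl (hs ▸ h)
  · rw [hs] at h
    rcases h with h | h
    · exact Or.inl h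
    · have h : o = some m := h
      subst h
      exact Or.inr ⟨hv, es, he, hl⟩

theorem node_inv (n : ℕ) (v : V) : ((X.cfg n).node v).Inv ((X.cfg n).sent v) := by
  induction n with
  | zero => rw [X.start]; exact Node.inv_init
  | succ n ih =>
    rcases step_cases X n v with ⟨hn, hs⟩ | ⟨hv, es, o, _, hl, hs⟩
    · rw [hn, hs]; exact ih
    · rw [hs]
      exact hl.inv (rcvd_subset X n v hv) ih

/-! ### Agreement -/

/-- A ready message comes from a quorum of votes or from a blocking set, which contains an intact
node that was ready earlier; going back in time ends at votes. Nothing is claimed about members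
outside `I`. -/
theorem exists_quorum_vote_cmt (hI : F.IsIntact I) {n : ℕ} {v : V} (hv : v ∈ I) {b : Ballot Val}
    (h : ⟨.ready, .cmt b⟩ ∈ (X.cfg n).sent v) :
    ∃ (w : ok) (U : Set V), (w : V) ∈ I ∧ (F.view w).IsQuorum U ∧ (w : V) ∈ U ∧
      ∀ u ∈ U, u ∈ I → ⟨.vote, .cmt b⟩ ∈ (X.cfg n).sent u := by
  induction n generalizing v with
  | zero => simp [X.start] at h
  | succ n ih =>
    suffices h' : ∃ (w : ok) (U : Set V), (w : V) ∈ I ∧ (F.view w).IsQuorum U ∧ (w : V) ∈ U ∧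
        ∀ u ∈ U, u ∈ I → ⟨.vote, .cmt b⟩ ∈ (X.cfg n).sent u by
      obtain ⟨w, U, hw, hU, hwU, hm⟩ := h'
      exact ⟨w, U, hw, hU, hwU, fun u hu huI => sent_subset_succ X n u (hm u hu huI)⟩
    rcases mem_sent_succ X h with h | ⟨hvok, es, _, hl⟩
    · exact ih hv h
    · rcases hl.of_ready_cmt rfl with ⟨U, hU, hvU, hm⟩ | ⟨B, hB, hm⟩
      · exact ⟨⟨v, hvok⟩, U, hv, hU, hvU,
          fun u hu huI => rcvd_subset X n v (hI.2.1 huI) (hm u hu)⟩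
      · obtain ⟨u, huI, huB⟩ := hI.exists_mem_of_isBlocking (v := ⟨v, hvok⟩) hv hB
        exact ih huI (rcvd_subset X n v (hI.2.1 huI) (hm u huB))

/-- A node that has voted for preparing a higher ballot does not vote for committing any more. -/
theorem vote_cmt_of_vote_prep {n m : ℕ} (hnm : m ≤ n) {u : V} {b c : Ballot Val} (hbc : b < c)
    (hc : ⟨.vote, .prep c⟩ ∈ (X.cfg m).sent u) (hb : ⟨.vote, .cmt b⟩ ∈ (X.cfg n).sent u) :
    ⟨.vote, .cmt b⟩ ∈ (X.cfg m).sent u := by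
  induction n, hnm using Nat.le_induction with
  | base => exact hb
  | succ n hnm ih =>
    rcases mem_sent_succ X hb with h | ⟨_, es, _, hl⟩
    · exact ih h
    -- A vote for committing `b` cast now would need `b` to be the highest ballot voted for
    -- preparing, against the vote for `c`.
    · have h1 := (node_inv X n u).vote_prep_le c (sent_mono X hnm u hc)
      rw [(hl.of_vote_cmt rfl).1] at h1
      exact absurd hbc (not_lt.2 h1)

/-- Consider the first intact node that is ready to abort `b`. A blocking set would contain an
earlier one. A quorum of votes shares an intact node with `U`, and that node votes both for
committing `b` and for preparing some `c` that contradicts `b`, which it does only after being ready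
to abort `b` itself. The votes in `U` may be cast as late as step `n`, after the step `m` of the
induction. -/
theorem not_readyAbove (hI : F.IsIntact I) {n : ℕ} {b : Ballot Val} {w : ok} {U : Set V}
    (hw : (w : V) ∈ I) (hU : (F.view w).IsQuorum U) (hwU : (w : V) ∈ U)
    (hm : ∀ u ∈ U, u ∈ I → ⟨.vote, .cmt b⟩ ∈ (X.cfg n).sent u) {m : ℕ} (hmn : m ≤ n) {v : V}
    (hv : v ∈ I) : ¬ ReadyAbove ((X.cfg m).sent v) b := by
  induction m generalizing v with
  | zero => rintro ⟨b', h, _⟩; simp [X.start] at h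
  | succ m ih =>
    rintro ⟨b', h, hl⟩
    rcases mem_sent_succ X h with h | ⟨hvok, es, _, hloc⟩
    · exact ih (by omega) hv ⟨b', h, hl⟩
    · rcases hloc.of_ready_prep rfl with ⟨U', hU', hvU', hm'⟩ | ⟨B, hB, hm'⟩
      · obtain ⟨u, huI, huU, huU'⟩ := hI.inter_nonempty
          (SubjectiveFBQS.isQuorumWithin_of_isQuorum hU)
          (SubjectiveFBQS.isQuorumWithin_of_isQuorum (v := ⟨v, hvok⟩) hU') hw hwU hv hvU'
        obtain ⟨c, hc, hcov⟩ := hm' u huU'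
        have hc' := rcvd_subset X m v (hI.2.1 huI) hc
        have hbc := hcov b hl
        -- The vote for committing `b`, known only at step `n`, must precede the vote for preparing
        -- `c`, so both are present at step `m`.
        exact ih (by omega) huI ((node_inv X m u).vote_prep_above c hc' b
          (vote_cmt_of_vote_prep X (by omega) hbc.1 hc' (hm u huU huI)) hbc)
      · obtain ⟨u, huI, huB⟩ := hI.exists_mem_of_isBlocking (v := ⟨v, hvok⟩) hv hB
        obtain ⟨c, hc, hcov⟩ := hm' u huB
        exact ih (by omega) huI ⟨c, rcvd_subset X m v (hI.2.1 huI) hc, hcov b hl⟩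

/-- An intact voter for committing `b'` has been ready to prepare it, hence to abort every `b`
incompatibly below it. -/
theorem not_lic_of_ready_cmt (hI : F.IsIntact I) {n : ℕ} {v v' : V} (hv : v ∈ I) (hv' : v' ∈ I)
    {b b' : Ballot Val} (h : ⟨.ready, .cmt b⟩ ∈ (X.cfg n).sent v)
    (h' : ⟨.ready, .cmt b'⟩ ∈ (X.cfg n).sent v') : ¬ b.Lic b' := by
  intro hl
  obtain ⟨w, U, hw, hU, hwU, hm⟩ := exists_quorum_vote_cmt X hI hv h
  obtain ⟨w', U', hw', _, hwU', hm'⟩ := exists_quorum_vote_cmt X hI hv' h'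
  exact not_readyAbove X hI hw hU hwU hm le_rfl hw'
    ((node_inv X n w').vote_cmt_above b' (hm' w' hwU' hw') b hl)

/-- Intact nodes are ready to commit ballots of a single value. -/
theorem agreement (hI : F.IsIntact I) {n n' : ℕ} {v v' : V} (hv : v ∈ I) (hv' : v' ∈ I)
    {b b' : Ballot Val} (h : ⟨.ready, .cmt b⟩ ∈ (X.cfg n).sent v)
    (h' : ⟨.ready, .cmt b'⟩ ∈ (X.cfg n').sent v') : b.val = b'.val := by
  have h := sent_mono X (le_max_left n n') v h
  have h' := sent_mono X (le_max_right n n') v' h'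
  by_contra hne
  rcases lt_trichotomy b b' with hlt | rfl | hlt
  · exact not_lic_of_ready_cmt X hI hv hv' h h' ⟨hlt, hne⟩
  · exact hne rfl
  · exact not_lic_of_ready_cmt X hI hv' hv h' h ⟨hlt, Ne.symm hne⟩

/-! ### Validity -/

/-- The node `v` has proposed `x` in the first `n` steps. -/
def Proposed (n : ℕ) (v : V) (x : Val) : Prop :=
  ∃ j < n, CEvent.hist (.propose v x) ∈ X.events j

/-- The nodes of `I` that have proposed at least `z` in the first `n` steps. -/
def proposers (I : Set V) (n : ℕ) (z : Val) : Set V := {v | v ∈ I ∧ ∃ x, z ≤ x ∧ Proposed X n v x}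

/-- The proposals of the first `n` steps allow all intact nodes to abort the ballots below
`⟨1, z⟩`. -/
def Supported (I : Set V) (n : ℕ) (z : Val) : Prop :=
  ∀ v ∈ I, F.CanReady I (proposers X I n z) v

theorem proposers_mono (n : ℕ) {z z' : Val} (h : z' ≤ z) :
    proposers X I n z ⊆ proposers X I (n + 1) z' := by
  rintro v ⟨hv, x, hx, j, hj, he⟩
  exact ⟨hv, x, h.trans hx, j, by omega, he⟩

variable {X}

theorem Supported.mono {n : ℕ} {z z' : Val} (h : z' ≤ z) (hs : Supported X I n z) :
    Supported X I (n + 1) z' := fun v hv => (hs v hv).mono (proposers_mono X n h)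

variable (X)

/-- The values that an intact node uses are supported by proposals. -/
structure Valid (I : Set V) (n : ℕ) (v : V) : Prop where
  cand : ∀ x, ((X.cfg n).node v).cons.cand.val = some x → Supported X I n x ∨ v ∈ proposers X I n x
  prepared : ∀ x, ((X.cfg n).node v).cons.prepared.val = some x → Supported X I n x
  vote_prep : ∀ b x, ⟨.vote, .prep b⟩ ∈ (X.cfg n).sent v → b.val = some x →
    Supported X I n x ∨ v ∈ proposers X I n x
  vote_cmt : ∀ b x, ⟨.vote, .cmt b⟩ ∈ (X.cfg n).sent v → b.val = some x → Supported X I n x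
  ready_cmt : ∀ b x, ⟨.ready, .cmt b⟩ ∈ (X.cfg n).sent v → b.val = some x → Supported X I n x

/-- The values that a correct node prepares are supported by proposals, or at least for the node
itself. -/
def ReadyValid (I : Set V) (n : ℕ) (v : V) : Prop :=
  ∀ b x, ⟨.ready, .prep b⟩ ∈ (X.cfg n).sent v → b.val = some x →
    Supported X I n x ∨ F.CanReady I (proposers X I n x) v

/-- A value enters through a proposal and passes on through covering, which can only lower it, and
lowering `z` enlarges the set of proposers. Quorums and blocking sets of messages mirror the two
constructors of `CanReady`. Ready messages are followed at all correct nodes, since a blocking set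
may contain correct nodes outside `I`; votes are followed only in `I`. -/
theorem valid (hI : F.IsIntact I) (n : ℕ) :
    (∀ v ∈ I, Valid X I n v) ∧ ∀ v, ReadyValid X I n v := by
  induction n with
  | zero =>
    refine ⟨fun v _ => ⟨?_, ?_, ?_, ?_, ?_⟩, fun v => ?_⟩ <;>
      simp [X.start, Node.init, Consensus.init, ReadyValid]
  | succ n ih =>
    obtain ⟨ih, ihr⟩ := ih
    have own : ∀ {v x}, Supported X I n x ∨ v ∈ proposers X I n x →
        Supported X I (n + 1) x ∨ v ∈ proposers X I (n + 1) x := fun h =>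
      h.imp (Supported.mono le_rfl) fun h => proposers_mono X n le_rfl h
    -- Delivery at one intact node upgrades the support of single nodes to support at all of `I`, by
    -- the cascade of ready messages.
    have hdel : ∀ {v : V} (hv : v ∈ I) {b : Ballot Val} {x : Val}, b.val = some x →
        QuorumPrep (F.view ⟨v, hI.2.1 hv⟩) v ((X.cfg n).rcvd v) .ready b →
        Supported X I (n + 1) x := by
      rintro v hv b x hx ⟨U, hU, hvU, hm⟩
      -- Assuming that `x` is not supported leaves, for each intact member of the quorum, only the
      -- alternative that this node can itself become ready.
      by_contra hns
      refine hns (hI.canReady_of_isQuorum (v := ⟨v, hI.2.1 hv⟩) hv hU hvU fun u hu huI => ?_)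
      obtain ⟨c, hc, hcov⟩ := hm u hu
      obtain ⟨y, hy, hxy⟩ := hcov.exists_val_le hx
      rcases ihr u c y (rcvd_subset X n v (hI.2.1 huI) hc) hy with h | h
      · exact absurd (h.mono hxy) hns
      · exact h.mono (proposers_mono X n hxy)
    refine ⟨fun v hv => ?_, fun v => ?_⟩
    · have hi := ih v hv
      have hvok := hI.2.1 hv
      have hprop : ∀ {es : List (CEvent V Val)} {x}, (∀ e ∈ es, e ∈ X.events n) →
          .hist (.propose v x) ∈ es → v ∈ proposers X I (n + 1) x :=
        fun he hp => ⟨hv, _, le_rfl, n, Nat.lt_succ_self n, he _ hp⟩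
      constructor
      · intro x hx
        rcases step_cases X n v with ⟨hn, _⟩ | ⟨_, es, o, he, hl, _⟩
        · rw [hn] at hx
          exact own (hi.cand x hx)
        · rcases hl.val_cand with ⟨y, hy, hp⟩ | h | h | h
          · rw [hx, Option.some.injEq] at hy
            subst hy
            exact Or.inr (hprop he hp)
          · exact own (hi.cand x (h ▸ hx))
          · exact Or.inl ((hi.prepared x (h ▸ hx)).mono le_rfl)
          · exact Or.inl (hdel hv hx h)
      · intro x hx
        rcases step_cases X n v with ⟨hn, _⟩ | ⟨_, es, o, he, hl, _⟩
        · rw [hn] at hx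
          exact (hi.prepared x hx).mono le_rfl
        · rcases hl.prepared_eq with h | h
          · exact (hi.prepared x (h ▸ hx)).mono le_rfl
          · exact hdel hv hx h
      · intro b x hm hx
        rcases mem_sent_succ X hm with hm | ⟨_, es, he, hl⟩
        · exact own (hi.vote_prep b x hm hx)
        · rcases hl.of_vote_prep rfl with ⟨y, rfl, hp⟩ | rfl
          · simp only [Ballot.val_mk, Option.some.injEq] at hx
            subst hx
            exact Or.inr (hprop he hp)
          · rw [Consensus.val_nextCand] at hx
            split_ifs at hx
            · exact own (hi.cand x hx)
            · exact Or.inl ((hi.prepared x hx).mono le_rfl)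
      · intro b x hm hx
        rcases mem_sent_succ X hm with hm | ⟨_, es, he, hl⟩
        · exact (hi.vote_cmt b x hm hx).mono le_rfl
        · exact hdel hv hx (hl.of_vote_cmt rfl).2
      · intro b x hm hx
        rcases mem_sent_succ X hm with hm | ⟨_, es, he, hl⟩
        · exact (hi.ready_cmt b x hm hx).mono le_rfl
        -- The quorum of votes contains the node itself, so its own vote suffices; a blocking set
        -- contains an intact node.
        · rcases hl.of_ready_cmt rfl with ⟨U, _, hvU, hm⟩ | ⟨B, hB, hm⟩
          · exact (hi.vote_cmt b x (rcvd_subset X n v hvok (hm v hvU)) hx).mono le_rfl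
          · obtain ⟨u, huI, huB⟩ := hI.exists_mem_of_isBlocking (v := ⟨v, hvok⟩) hv hB
            exact ((ih u huI).ready_cmt b x (rcvd_subset X n v (hI.2.1 huI) (hm u huB)) hx).mono
              le_rfl
    · intro b x hm hx
      by_cases hns : Supported X I (n + 1) x
      · exact Or.inl hns
      right
      rcases mem_sent_succ X hm with hm | ⟨hvok, es, he, hl⟩
      · rcases ihr v b x hm hx with h | h
        · exact absurd (h.mono le_rfl) hns
        · exact h.mono (proposers_mono X n le_rfl)
      · rcases hl.of_ready_prep rfl with ⟨U, hU, hvU, hm⟩ | ⟨B, hB, hm⟩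
        · refine .quorum ⟨v, hvok⟩ U hU hvU ?_
          rintro u ⟨hu, huI⟩
          obtain ⟨c, hc, hcov⟩ := hm u hu
          obtain ⟨y, hy, hxy⟩ := hcov.exists_val_le hx
          rcases (ih u huI).vote_prep c y (rcvd_subset X n v (hI.2.1 huI) hc) hy with h | h
          · exact absurd (h.mono hxy) hns
          · exact proposers_mono X n hxy h
        · refine .blocking ⟨v, hvok⟩ B hB fun u hu huok => ?_
          obtain ⟨c, hc, hcov⟩ := hm u hu
          obtain ⟨y, hy, hxy⟩ := hcov.exists_val_le hx
          rcases ihr u c y (rcvd_subset X n v huok hc) hy with h | h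
          · exact absurd (h.mono hxy) hns
          · exact h.mono (proposers_mono X n hxy)

end Global

end CSCP

/-! ## Visible events of a step -/

section Visible

variable {V E H : Type*}

open Classical in
/-- The event of the history that corresponds to `e`, if any, when `e` occurs in `I`. -/
noncomputable def visible (node : E → V) (f : E → Option H) (I : Set V) (e : E) : Option H :=
  if node e ∈ I then f e else none

variable {node : E → V} {f : E → Option H} {I : Set V}

theorem Trace.filterMap_project_concat (ℓ : ℕ → List E) :
    filterMap f (project node I (concat ℓ)) =
      concat fun k => (ℓ k).filterMap (visible node f I) := by
  unfold project
  rw [filterMap_concat, filterMap_concat]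
  congr 1
  funext k
  rw [List.filterMap_filterMap]
  congr 1
  funext e
  unfold visible
  split_ifs <;> rfl

theorem filterMap_visible_of_mem {es : List E} (h : ∀ e ∈ es, node e ∈ I) :
    es.filterMap (visible node f I) = es.filterMap f :=
  List.filterMap_congr fun e he => if_pos (h e he)

theorem filterMap_visible_of_notMem {es : List E} (h : ∀ e ∈ es, node e ∉ I) :
    es.filterMap (visible node f I) = [] :=
  List.filterMap_eq_nil_iff.2 fun e he => if_neg (h e he)

theorem filterMap_visible_of_eq_nil {es : List E} (h : es.filterMap f = []) :
    es.filterMap (visible node f I) = [] := by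
  rw [List.filterMap_eq_nil_iff] at h ⊢
  intro e he
  unfold visible
  split_ifs
  · exact h e he
  · rfl

theorem filterMap_visible_sendEvents {M : Type*} [Fintype V] {sendE : V → M → V → E}
    (hf : ∀ v m u, f (sendE v m u) = none) (v : V) (o : Option M) :
    (sendEvents sendE v o).filterMap (visible node f I) = [] := by
  refine filterMap_visible_of_eq_nil (List.filterMap_eq_nil_iff.2 fun e he => ?_)
  simp only [sendEvents, List.mem_flatMap, List.mem_map] at he
  obtain ⟨m, _, u, _, rfl⟩ := he
  exact hf v m u

end Visible

namespace CSCP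

variable {V : Type*} [Fintype V] [DecidableEq V] {Val : Type*} [LinearOrder Val] {ok : Set V}
  {F : SubjectiveFBQS ok} {I : Set V} (X : Exec Val F)

/-- The events of the history that occur in `I` at step `n`. -/
noncomputable def hist (I : Set V) (n : ℕ) : List (HistEvent V Val) :=
  (X.events n).filterMap (visible CEvent.node CEvent.toHist I)

theorem history_project : CEvent.history (CEvent.project I X.trace) = Trace.concat (hist X I) :=
  Trace.filterMap_project_concat _

/-- Whether `v` has proposed and whether it has stopped. -/
def flags (n : ℕ) (v : V) : Bool × Bool :=
  (((X.cfg n).node v).cons.proposed, ((X.cfg n).node v).cons.stopped)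

theorem propose_mem_hist {n : ℕ} {v : V} {x : Val} (hv : v ∈ I)
    (h : CEvent.hist (.propose v x) ∈ X.events n) : .propose v x ∈ hist X I n :=
  List.mem_filterMap.2 ⟨_, h, if_pos hv⟩

/-- Everything about a step that the abstract side must reproduce. The two flags decide which events
of the history remain enabled, and the ready message links a decision to agreement and validity. -/
theorem hist_cases (hI : F.IsIntact I) (n : ℕ) :
    (hist X I n = [] ∧ ∀ v ∈ I, flags X (n + 1) v = flags X n v) ∨
    (∃ v ∈ I, ∃ x, hist X I n = [.propose v x] ∧ flags X n v = (false, false) ∧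
      flags X (n + 1) v = (true, false) ∧ ∀ u ∈ I, u ≠ v → flags X (n + 1) u = flags X n u) ∨
    (∃ v ∈ I, ∃ b z, hist X I n = [.decide v z] ∧ b.val = some z ∧
      ⟨.ready, .cmt b⟩ ∈ (X.cfg n).sent v ∧ (flags X n v).2 = false ∧
      flags X (n + 1) v = ((flags X n v).1, true) ∧
      ∀ u ∈ I, u ≠ v → flags X (n + 1) u = flags X n u) := by
  have h := X.step n
  have hrc := fun v (hv : v ∈ I) => rcvd_subset X n v (hI.2.1 hv)
  unfold flags hist
  generalize X.cfg n = c, X.cfg (n + 1) = c', X.events n = es at h hrc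
  cases h with
  | receive w u m _ _ _ =>
    exact Or.inl ⟨filterMap_visible_of_eq_nil rfl, fun _ _ => rfl⟩
  | idle => exact Or.inl ⟨rfl, fun _ _ => rfl⟩
  | act w es o n' hs h =>
    have hsend : (sendEvents CEvent.send (w : V) o).filterMap
        (visible CEvent.node (CEvent.toHist (Val := Val)) I) = [] :=
      filterMap_visible_sendEvents (fun _ _ _ => rfl) _ _
    rw [List.filterMap_append, hsend, List.append_nil]
    have hother : ∀ u : V, u ≠ w → Function.update c.node w n' u = c.node u :=
      fun u hu => Function.update_of_ne hu _ _
    have hself : Function.update c.node (w : V) n' w = n' := Function.update_self _ _ _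
    by_cases hw : (w : V) ∈ I
    · rw [filterMap_visible_of_mem fun e he => (h.node_eq e he).symm ▸ hw]
      rcases h.hist_cases with ⟨h1, h2, h3⟩ | ⟨x, h1, _, h2, h3, h4⟩ | ⟨b, z, h1, h2, h3, h4, h5⟩
      · refine Or.inl ⟨h1, fun u hu => ?_⟩
        by_cases huw : u = w
        · subst huw
          simp only [hself, h2, h3]
        · simp only [hother u huw]
      · refine Or.inr (Or.inl ⟨w, hw, x, h1, by simp only [h2, hs], by
          simp only [hself, h3, h4, hs], fun u _ huw => by simp only [hother u huw]⟩)
      · refine Or.inr (Or.inr ⟨w, hw, b, z, h1, h2, hrc w hw h3, hs, by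
          simp only [hself, h4, h5], fun u _ huw => by simp only [hother u huw]⟩)
    · rw [filterMap_visible_of_notMem fun e he => (h.node_eq e he).symm ▸ hw]
      refine Or.inl ⟨rfl, fun u hu => ?_⟩
      have huw : u ≠ w := fun h => hw (h ▸ hu)
      simp only [hother u huw]

end CSCP

/-! ## Executions of the abstract protocol -/

namespace ASCP

variable {V : Type*} [Fintype V] [DecidableEq V] {Val : Type*} [LinearOrder Val] {ok : Set V}
  {F : SubjectiveFBQS ok} {I : Set V}

/-- The steps of the abstract protocol. -/
abbrev Step (F : SubjectiveFBQS ok) (Val : Type*) [LinearOrder Val] :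
    Config V (Node Val) (Batch Val) → List (AEvent V Val) →
      Config V (Node Val) (Batch Val) → Prop :=
  NetStep ok (fun n => n.cons.stopped) (fun v => Local (F.view v) (v : V))
    AEvent.sendBatch AEvent.receiveBatch

/-- The visible events of the abstract protocol. -/
noncomputable abbrev vis (I : Set V) : AEvent V Val → Option (HistEvent V Val) :=
  visible AEvent.node AEvent.toHist I

theorem exists_exec_of_produces {h : ℕ → List (HistEvent V Val)}
    (hp : Produces (Step F Val) (vis I)
      { node := fun _ => Node.init Val, sent := fun _ => ∅, rcvd := fun _ _ => ∅ } h) :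
    ∃ Y : Exec Val F, AEvent.history (AEvent.project I Y.trace) = Trace.concat h := by
  obtain ⟨cfg, ev, h0, hs, hh⟩ := hp
  exact ⟨⟨cfg, ev, h0, hs⟩, (Trace.filterMap_project_concat _).trans hh⟩

/-- The configuration after a handler of `v`. -/
def afterAct (c : Config V (Node Val) (Batch Val)) (v : V) (n' : Node Val)
    (o : Option (Batch Val)) : Config V (Node Val) (Batch Val) where
  node := Function.update c.node v n'
  sent := Function.update c.sent v (c.sent v ∪ {m | o = some m})
  rcvd := c.rcvd

theorem exists_act {c : Config V (Node Val) (Batch Val)} {v : V} (hv : v ∈ ok)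
    (hs : (c.node v).cons.stopped = false) {es : List (AEvent V Val)} {o : Option (Batch Val)}
    {n' : Node Val} (h : Local (F.view ⟨v, hv⟩) v (c.rcvd v) (c.node v) es o n') :
    ∃ e, Step F Val c e (afterAct c v n' o) ∧ e.filterMap (vis I) = es.filterMap (vis I) := by
  refine ⟨_, NetStep.act c ⟨v, hv⟩ es o n' hs h, ?_⟩
  rw [List.filterMap_append, filterMap_visible_sendEvents (fun _ _ _ => rfl), List.append_nil]

theorem silent_act {c : Config V (Node Val) (Batch Val)} {v : V} (hv : v ∈ ok)
    (hs : (c.node v).cons.stopped = false) {es : List (AEvent V Val)} {o : Option (Batch Val)}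
    {n' : Node Val} (h : Local (F.view ⟨v, hv⟩) v (c.rcvd v) (c.node v) es o n')
    (hes : es.filterMap (vis I) = []) :
    Silent (Step F Val) (vis I) c (afterAct c v n' o) := by
  obtain ⟨e, he, hh⟩ := exists_act (I := I) hv hs h
  exact .single ⟨e, he, hh.trans hes⟩

/-- The configurations `c` and `c'` differ only by messages received in `c'`. -/
structure Extends (c c' : Config V (Node Val) (Batch Val)) : Prop where
  node : c'.node = c.node
  sent : c'.sent = c.sent
  rcvd : ∀ v u, c.rcvd v u ⊆ c'.rcvd v u

theorem silent_receive (c : Config V (Node Val) (Batch Val)) {v : V} (hv : v ∈ ok)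
    (hs : (c.node v).cons.stopped = false) (u : V) (m : Batch Val) (hm : u ∈ ok → m ∈ c.sent u) :
    ∃ c', Silent (Step F Val) (vis I) c c' ∧ Extends c c' ∧ m ∈ c'.rcvd v u := by
  by_cases hnew : m ∈ c.rcvd v u
  · exact ⟨c, .refl, ⟨rfl, rfl, fun _ _ => subset_rfl⟩, hnew⟩
  · refine ⟨_, .single ⟨_, NetStep.receive c ⟨v, hv⟩ u m hs hnew hm,
      filterMap_visible_of_eq_nil rfl⟩, ⟨rfl, rfl, fun v' u' => ?_⟩, ?_⟩
    · by_cases hv' : v' = v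
      · subst hv'
        by_cases hu' : u' = u
        · subst hu'
          simp
        · simp [hu']
      · simp [hv']
    · simp

theorem silent_receive_finset (c : Config V (Node Val) (Batch Val))
    (s : Finset (V × V × Batch Val))
    (h : ∀ t ∈ s, t.1 ∈ ok ∧ (c.node t.1).cons.stopped = false ∧
      (t.2.1 ∈ ok → t.2.2 ∈ c.sent t.2.1)) :
    ∃ c', Silent (Step F Val) (vis I) c c' ∧ Extends c c' ∧ ∀ t ∈ s, t.2.2 ∈ c'.rcvd t.1 t.2.1 := by
  classical
  induction s using Finset.induction_on with
  | empty => exact ⟨c, .refl, ⟨rfl, rfl, fun _ _ => subset_rfl⟩, by simp⟩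
  | insert t s _ ih =>
    obtain ⟨c', hc, he, hr⟩ := ih fun t ht => h t (Finset.mem_insert_of_mem ht)
    obtain ⟨h1, h2, h3⟩ := h t (Finset.mem_insert_self _ _)
    obtain ⟨c'', hc', he', hr'⟩ := silent_receive (F := F) (I := I) c' h1 (by rwa [he.node]) t.2.1
      t.2.2 (by rwa [he.sent])
    refine ⟨c'', hc.trans hc', ⟨he'.node.trans he.node, he'.sent.trans he.sent,
      fun v u => (he.rcvd v u).trans (he'.rcvd v u)⟩, fun t' ht' => ?_⟩
    rcases Finset.mem_insert.1 ht' with rfl | ht'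
    · exact hr'
    · exact he'.rcvd _ _ (hr t' ht')

/-- The nodes of `J` receive finitely many messages from every node. -/
theorem silent_receive_all (c : Config V (Node Val) (Batch Val)) {J : Set V} (hJ : J ⊆ ok)
    (hs : ∀ v ∈ J, (c.node v).cons.stopped = false) (W : V → Set (Batch Val))
    (hfin : ∀ u, (W u).Finite) (hW : ∀ u ∈ ok, W u ⊆ c.sent u) :
    ∃ c', Silent (Step F Val) (vis I) c c' ∧ Extends c c' ∧ ∀ v ∈ J, ∀ u, W u ⊆ c'.rcvd v u := by
  have hf : (⋃ v : V, ⋃ u : V, (fun m => (v, u, m)) '' W u).Finite :=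
    Set.finite_iUnion fun v => Set.finite_iUnion fun u => (hfin u).image _
  have hf' := hf.subset (Set.inter_subset_left (t := {t | t.1 ∈ J}))
  obtain ⟨c', hc, he, hr⟩ := silent_receive_finset (F := F) (I := I) c hf'.toFinset (by
    intro t ht
    simp only [Set.Finite.mem_toFinset, Set.mem_inter_iff, Set.mem_iUnion, Set.mem_image] at ht
    obtain ⟨⟨v, u, m, hm, rfl⟩, hv⟩ := ht
    exact ⟨hJ hv, hs v hv, fun hu => hW u hu hm⟩)
  refine ⟨c', hc, he, fun v hv u m hm => hr (v, u, m) ?_⟩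
  simp only [Set.Finite.mem_toFinset, Set.mem_inter_iff, Set.mem_iUnion, Set.mem_image]
  exact ⟨⟨v, u, m, hm, rfl⟩, hv⟩

/-! ### Synchronous rounds of the intact nodes -/

/-- All intact nodes satisfy `Φ` and have received all messages from each other. -/
structure Stage (I : Set V) (Φ : V → Node Val → Set (Batch Val) → Prop)
    (c : Config V (Node Val) (Batch Val)) : Prop where
  holds : ∀ v ∈ I, Φ v (c.node v) (c.sent v)
  running : ∀ v ∈ I, (c.node v).cons.stopped = false
  finite : ∀ v ∈ I, (c.sent v).Finite
  rcvd : ∀ v ∈ I, ∀ u ∈ I, c.sent u ⊆ c.rcvd v u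

/-- In one round of the intact nodes, each of them runs at most one handler without visible events,
and then they exchange their messages. -/
theorem Stage.advance (hI : I ⊆ ok) {Φ Φ' : V → Node Val → Set (Batch Val) → Prop}
    {c : Config V (Node Val) (Batch Val)} (hc : Stage I Φ c)
    (h : ∀ v (hv : v ∈ I) rc n s, Φ v n s → n.cons.stopped = false →
      (∀ u ∈ I, ∃ n' s', Φ u n' s' ∧ s' ⊆ rc u) →
      Φ' v n s ∨ ∃ es o n', Local (F.view ⟨v, hI hv⟩) v rc n es o n' ∧
        es.filterMap AEvent.toHist = [] ∧ n'.cons.stopped = false ∧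
        Φ' v n' (s ∪ {m | o = some m})) :
    ∃ c', Silent (Step F Val) (vis I) c c' ∧ Stage I Φ' c' := by
  classical
  -- The nodes act one after another, but nothing is received in the meantime, so each handler sees
  -- the messages from the start of the round.
  have key : ∀ s : Finset V, (∀ v ∈ s, v ∈ I) → ∃ c', Silent (Step F Val) (vis I) c c' ∧
      (∀ v ∈ s, Φ' v (c'.node v) (c'.sent v)) ∧
      (∀ v ∉ s, c'.node v = c.node v ∧ c'.sent v = c.sent v) ∧ c'.rcvd = c.rcvd ∧
      (∀ v ∈ I, (c'.node v).cons.stopped = false) ∧ ∀ v ∈ I, (c'.sent v).Finite := by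
    intro s
    induction s using Finset.induction_on with
    | empty => exact fun _ => ⟨c, .refl, by simp, fun _ _ => ⟨rfl, rfl⟩, rfl, hc.running, hc.finite⟩
    | insert v s hvs ih =>
      intro hs
      obtain ⟨c', h1, h2, h3, h4, h5, h6⟩ := ih fun u hu => hs u (Finset.mem_insert_of_mem hu)
      have hv := hs v (Finset.mem_insert_self _ _)
      obtain ⟨hn, hsent⟩ := h3 v hvs
      rcases h v hv (c.rcvd v) (c.node v) (c.sent v) (hc.holds v hv) (hc.running v hv)
        (fun u hu => ⟨_, _, hc.holds u hu, hc.rcvd v hv u hu⟩) with hΦ | ⟨es, o, n', hl, hes, hst, hΦ⟩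
      · refine ⟨c', h1, fun u hu => ?_, fun u hu => h3 u fun h => hu (Finset.mem_insert_of_mem h),
          h4, h5, h6⟩
        rcases Finset.mem_insert.1 hu with rfl | hu
        · rwa [hn, hsent]
        · exact h2 u hu
      · rw [← hn, ← h4] at hl
        refine ⟨afterAct c' v n' o, h1.trans (silent_act (hI hv) (h5 v hv) hl
          (filterMap_visible_of_eq_nil hes)), fun u hu => ?_, fun u hu => ?_, h4, fun u hu => ?_,
          fun u hu => ?_⟩
        · by_cases huv : u = v
          · subst huv
            simpa [afterAct, hsent] using hΦ
          · simpa [afterAct, huv] using h2 u ((Finset.mem_insert.1 hu).resolve_left huv)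
        · have huv : u ≠ v := fun h => hu (h ▸ Finset.mem_insert_self _ _)
          simpa [afterAct, huv] using h3 u fun h => hu (Finset.mem_insert_of_mem h)
        · by_cases huv : u = v
          · subst huv
            simpa [afterAct] using hst
          · simpa [afterAct, huv] using h5 u hu
        · by_cases huv : u = v
          · subst huv
            have : {m | o = some m}.Finite :=
              Set.Subsingleton.finite fun a (ha : o = some a) b (hb : o = some b) =>
                Option.some_injective _ (ha.symm.trans hb)
            simpa [afterAct] using ⟨h6 u hu, this⟩
          · simpa [afterAct, huv] using h6 u hu
  obtain ⟨c', h1, h2, _, _, h5, h6⟩ := key (Finset.univ.filter (· ∈ I)) (by simp)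
  -- The exchange closes the round. It takes finitely many steps, because each node has sent
  -- finitely many batches, even if these are infinite.
  obtain ⟨c'', h1', he, hr⟩ := silent_receive_all (F := F) (I := I) c' hI h5
    (fun u => if u ∈ I then c'.sent u else ∅)
    (fun u => by
      by_cases hu : u ∈ I
      · simpa [hu] using h6 u hu
      · simp [hu])
    (fun u _ => by
      by_cases hu : u ∈ I
      · simp [hu]
      · simp [hu])
  refine ⟨c'', h1.trans h1', fun v hv => ?_, fun v hv => ?_, fun v hv => ?_, fun v hv u hu => ?_⟩
  · rw [he.node, he.sent]
    exact h2 v (by simpa using hv)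
  · rw [he.node]
    exact h5 v hv
  · rw [he.sent]
    exact h6 v hv
  · rw [he.sent]
    simpa [hu] using hr v hv u

end ASCP

/-! ### From ready messages for `⟨1, z⟩` to the delivery of `true` for `⟨2, z⟩`. -/

namespace ASCP

section Batch

variable {Val : Type*}

/-- The messages of kind `k` that carry `a`, for the instances of the ballots in `bs`. -/
def batch (k : MsgKind) (bs : Set (Ballot Val)) (a : Bool) : Batch Val :=
  {m | ∃ b ∈ bs, m = ⟨k, b, a⟩}

theorem Got.mono {s t : Set (Batch Val)} (h : s ⊆ t) {m : AMsg Val} (hm : Got s m) : Got t m := by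
  obtain ⟨ms, hms, hm⟩ := hm
  exact ⟨ms, h hms, hm⟩

theorem got_batch {s : Set (Batch Val)} {k : MsgKind} {bs : Set (Ballot Val)} {a : Bool}
    (hs : batch k bs a ∈ s) {b : Ballot Val} (hb : b ∈ bs) : Got s ⟨k, b, a⟩ :=
  ⟨_, hs, b, hb, rfl⟩

end Batch

section Rounds

variable {V : Type*} [Fintype V] [DecidableEq V] {Val : Type*} [LinearOrder Val] {ok : Set V}
  {F : SubjectiveFBQS ok} {I : Set V}

/-- The progress of an intact node: whether it has proposed, the instances that are ready, the
delivered Booleans, some messages that it has sent, and a condition on the other fields. -/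
structure Progress (q : V → Bool) (R : Set (Ballot Val)) (d : Ballot Val → Option Bool)
    (M : Set (AMsg Val)) (E : Consensus Val → Set (Ballot Val) → Set (Batch Val) → Prop)
    (v : V) (n : Node Val) (s : Set (Batch Val)) : Prop where
  proposed : n.cons.proposed = q v
  ready : n.ready = R
  delivered : n.delivered = d
  msgs : ∀ m ∈ M, Got s m
  extra : E n.cons n.voted s

variable {q : V → Bool} {R bs : Set (Ballot Val)} {d d' : Ballot Val → Option Bool}
  {M M' : Set (AMsg Val)} {E E' : Consensus Val → Set (Ballot Val) → Set (Batch Val) → Prop}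
  {c : Config V (Node Val) (Batch Val)} {a : Bool}

/-- A round of ready messages, after votes from all intact nodes. -/
theorem Stage.ready (hI : F.IsIntact I) (hc : Stage I (Progress q R d M E) c)
    (hM : batch .vote bs a ⊆ M) (hR : ∀ b ∈ bs, b ∉ R)
    (hE : ∀ k w s t, E k w s → E k w (s ∪ t)) :
    ∃ c', Silent (Step F Val) (vis I) c c' ∧
      Stage I (Progress q (R ∪ bs) d (batch .ready bs a) E) c' := by
  refine hc.advance hI.2.1 fun v hv rc n s hn hst hrc => ?_
  rcases bs.eq_empty_or_nonempty with rfl | hne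
  · refine Or.inl ⟨hn.proposed, by simp [hn.ready], hn.delivered, ?_, hn.extra⟩
    rintro m ⟨b, hb, _⟩
    exact absurd hb (Set.notMem_empty b)
  · refine Or.inr ⟨_, _, _, .ready bs a hne fun b hb => ⟨hn.ready ▸ hR b hb, Or.inl ⟨I,
      hI.isQuorum (v := ⟨v, hI.2.1 hv⟩) hv, hv, fun u hu => ?_⟩⟩, rfl, hst, ?_⟩
    · obtain ⟨n', s', hn', hs'⟩ := hrc u hu
      exact (hn'.msgs _ (hM ⟨b, hb, rfl⟩)).mono hs'
    · refine ⟨hn.proposed, by simp [hn.ready], hn.delivered, ?_, hE _ _ _ _ hn.extra⟩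
      rintro m hm
      exact ⟨_, Or.inr rfl, hm⟩

/-- A round of deliveries, after ready messages from all intact nodes. -/
theorem Stage.deliver (hI : F.IsIntact I) (hc : Stage I (Progress q R d M E) c)
    (hM : batch .ready bs a ⊆ M) (hd : ∀ b ∈ bs, d b = none) (hd' : ∀ b ∈ bs, d' b = some a)
    (hd'' : ∀ b ∉ bs, d' b = d b) :
    ∃ c', Silent (Step F Val) (vis I) c c' ∧ Stage I (Progress q R d' M E) c' := by
  refine hc.advance hI.2.1 fun v hv rc n s hn hst hrc => ?_
  rcases bs.eq_empty_or_nonempty with rfl | hne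
  · have : d' = d := funext fun b => hd'' b (Set.notMem_empty b)
    exact Or.inl (this ▸ hn)
  · refine Or.inr ⟨_, _, _, .deliver bs a hne d' (fun b hb => ⟨hn.delivered ▸ hd b hb, I,
      hI.isQuorum (v := ⟨v, hI.2.1 hv⟩) hv, hv, fun u hu => ?_⟩) hd' (hn.delivered ▸ hd''), rfl,
      hst, ?_⟩
    · obtain ⟨n', s', hn', hs'⟩ := hrc u hu
      exact (hn'.msgs _ (hM ⟨b, hb, rfl⟩)).mono hs'
    · have hs : s ∪ {m : Batch Val | none = some m} = s := by simp
      rw [hs]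
      exact ⟨hn.proposed, hn.ready, rfl, hn.msgs, hn.extra⟩

/-- A round of intact nodes that affects neither the ready nor the delivered instances. -/
theorem Stage.consensus (hI : F.IsIntact I) (hc : Stage I (Progress q R d M E) c)
    (h : ∀ v (hv : v ∈ I) rc n s, Progress q R d M E v n s → n.cons.stopped = false →
      (∀ u ∈ I, ∀ m ∈ M, Got (rc u) m) →
      ∃ es o n', Local (F.view ⟨v, hI.2.1 hv⟩) v rc n es o n' ∧
        es.filterMap AEvent.toHist = [] ∧ n'.cons.stopped = false ∧
        Progress q R d M' E' v n' (s ∪ {m | o = some m})) :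
    ∃ c', Silent (Step F Val) (vis I) c c' ∧ Stage I (Progress q R d M' E') c' := by
  refine hc.advance hI.2.1 fun v hv rc n s hn hst hrc => Or.inr (h v hv rc n s hn hst ?_)
  intro u hu m hm
  obtain ⟨n', s', hn', hs'⟩ := hrc u hu
  exact (hn'.msgs m hm).mono hs'

/-- Preparing a ballot at all intact nodes. -/
theorem Stage.prepare_one (hI : F.IsIntact I) {z : Val}
    (hc : Stage I (Progress q R d M fun k w s => (k.prepared = ⊥ ∧ k.round = 0) ∧
      (∀ b ∈ w, b.val ≠ some z → Got s ⟨.vote, b, false⟩) ∧ Ballot.mk 2 z ∉ w) c)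
    (hd : ∀ b : Ballot Val, b.Lic (Ballot.mk 1 z) → d b = some false) :
    ∃ c', Silent (Step F Val) (vis I) c c' ∧
      Stage I (Progress q R d M fun k w s => (k.prepared = Ballot.mk 1 z ∧ k.round = 0) ∧
        (∀ b ∈ w, b.val ≠ some z → Got s ⟨.vote, b, false⟩) ∧ Ballot.mk 2 z ∉ w) c' := by
  refine hc.consensus hI fun v hv rc n s hn hst _ => ?_
  obtain ⟨⟨hp, hr⟩, hw, hw'⟩ := hn.extra
  have hlt : n.cons.prepared < Ballot.mk 1 z := hp ▸ Ballot.bot_lt_mk _ _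
  have hd : ∀ b : Ballot Val, b.Lic (Ballot.mk 1 z) → n.delivered b = some false :=
    hn.delivered ▸ hd
  -- A node whose candidate is not above `⟨1, z⟩` also votes for committing it. This vote of `true`
  -- is harmless: the invariant on earlier votes speaks only of ballots with values other than `z`.
  by_cases hcand : n.cons.cand ≤ Ballot.mk 1 z
  · refine ⟨_, _, _, .preparedHigh _ hd hlt hcand, rfl, hst, hn.proposed, hn.ready, hn.delivered,
      fun m hm => (hn.msgs m hm).mono Set.subset_union_left, ⟨rfl, hr⟩, ?_, ?_⟩
    · rintro b (hb | rfl) hne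
      · exact (hw b hb hne).mono Set.subset_union_left
      · exact absurd rfl hne
    · rintro (h | h)
      · exact hw' h
      · have : Ballot.mk 1 z < Ballot.mk 2 z := Ballot.mk_lt_mk.2 (Or.inl (by decide))
        exact this.ne' h
  · have hs : s ∪ {m : Batch Val | none = some m} = s := by simp
    refine ⟨_, _, _, .preparedLow _ hd hlt hcand, rfl, hst, ?_⟩
    rw [hs]
    exact ⟨hn.proposed, hn.ready, hn.delivered, hn.msgs, ⟨rfl, hr⟩, hw, hw'⟩

/-- From ready messages for aborting all ballots below `⟨1, z⟩` to the delivery of `true` for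
`⟨2, z⟩`. -/
theorem Stage.deliver_two (hI : F.IsIntact I) {z : Val}
    (hc : Stage I (Progress q {b | b.Lic (Ballot.mk 1 z)} (fun _ => none)
      (batch .ready {b | b.Lic (Ballot.mk 1 z)} false) fun k w s =>
      (k.prepared = ⊥ ∧ k.round = 0) ∧
      (∀ b ∈ w, b.val ≠ some z → Got s ⟨.vote, b, false⟩) ∧ Ballot.mk 2 z ∉ w) c) :
    ∃ c', Silent (Step F Val) (vis I) c c' ∧ ∀ v ∈ I,
      (c'.node v).cons.proposed = q v ∧ (c'.node v).cons.stopped = false ∧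
      (c'.node v).delivered (Ballot.mk 2 z) = some true := by
  classical
  have h12 : (Ballot.mk 1 z : Ballot Val) < Ballot.mk 2 z :=
    Ballot.mk_lt_mk.2 (Or.inl (by decide))
  have hsub : ∀ b : Ballot Val, b.Lic (Ballot.mk 1 z) → b.Lic (Ballot.mk 2 z) :=
    fun b hb => ⟨hb.1.trans h12, hb.2⟩
  obtain ⟨c₁, s₁, hc⟩ := hc.deliver hI (bs := {b | b.Lic (Ballot.mk 1 z)}) (a := false)
    (d' := fun b => if b.Lic (Ballot.mk 1 z) then some false else none) subset_rfl
    (fun _ _ => rfl) (fun b hb => if_pos hb) (fun b hb => if_neg hb)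
  obtain ⟨c₂, s₂, hc⟩ := hc.prepare_one hI (fun b hb => if_pos hb)
  obtain ⟨c₃, s₃, hc⟩ := hc.consensus (M' := ∅) (E' := fun k w s =>
      (k.prepared = Ballot.mk 1 z ∧ k.round = 1 ∧ k.timer = true) ∧
      (∀ b ∈ w, b.val ≠ some z → Got s ⟨.vote, b, false⟩) ∧ Ballot.mk 2 z ∉ w) hI
    fun v hv rc n s hn hst hrc => by
      obtain ⟨⟨hp, hr⟩, hw, hw'⟩ := hn.extra
      have hs : s ∪ {m : Batch Val | none = some m} = s := by simp
      -- The quorum is `I` itself. Each member endorses `⟨1, z⟩` by its ready messages on the whole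
      -- interval from the null ballot.
      refine ⟨_, _, _, .round I (fun _ => Ballot.mk 1 z) 1
        (hI.isQuorum (v := ⟨v, hI.2.1 hv⟩) hv) hv (fun u hu => ⟨by simp [hr], .ready, Or.inr
          ⟨⊥, Ballot.bot_lt_mk _ _, fun b hb => hrc u hu _ ⟨b, Ballot.lic_mk_one_iff.2 hb.2, rfl⟩⟩⟩)
        ⟨⟨v, hv, rfl⟩, ?_⟩, rfl, hst, ?_⟩
      · rintro _ ⟨u, _, rfl⟩
        exact le_rfl
      · rw [hs]
        exact ⟨hn.proposed, hn.ready, hn.delivered, by simp, ⟨hp, rfl, rfl⟩, hw, hw'⟩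
  obtain ⟨c₄, s₄, hc⟩ := hc.consensus (M' := batch .vote {b | b.Lic (Ballot.mk 2 z)} false)
    (E' := fun k w _ => (k.prepared = Ballot.mk 1 z ∧ k.cand = Ballot.mk 2 z) ∧
      Ballot.mk 2 z ∉ w) hI
    fun v hv rc n s hn hst hrc => by
      obtain ⟨⟨hp, hr, ht⟩, hw, hw'⟩ := hn.extra
      -- The round is 1 and the prepared ballot has value `z`, whatever the node proposed.
      have hnext : n.cons.nextCand = Ballot.mk 2 z := by
        unfold Consensus.nextCand
        rw [hp, if_neg (Ballot.bot_lt_mk _ _).ne', hr]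
        rfl
      refine ⟨_, _, _, .timeout ht, rfl, hst, hn.proposed, hn.ready, hn.delivered, ?_,
        ⟨hp, hnext⟩, ?_⟩
      · rw [hnext]
        rintro _ ⟨b, hb, rfl⟩
        -- An instance that has voted ignores the new vote, but it voted `false`, since the value of
        -- `b` is not `z`; the required message has then been sent earlier.
        by_cases hbw : b ∈ n.voted
        · exact (hw b hbw hb.2).mono Set.subset_union_left
        · exact ⟨_, Or.inr rfl, b, hb, hbw, rfl⟩
      · rw [hnext]
        rintro (h | h)
        · exact hw' h
        · exact h.2 rfl
  -- Ready messages are sent once per instance, so only the ballots not already aborted for `⟨1, z⟩`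
  -- take part.
  obtain ⟨c₅, s₅, hc⟩ := hc.ready hI
    (bs := {b | b.Lic (Ballot.mk 2 z) ∧ ¬ b.Lic (Ballot.mk 1 z)}) (a := false)
    (by rintro _ ⟨b, hb, rfl⟩; exact ⟨b, hb.1, rfl⟩) (fun b hb => hb.2) (fun _ _ _ _ h => h)
  obtain ⟨c₆, s₆, hc⟩ := hc.deliver hI
    (bs := {b | b.Lic (Ballot.mk 2 z) ∧ ¬ b.Lic (Ballot.mk 1 z)}) (a := false)
    (d' := fun b => if b.Lic (Ballot.mk 2 z) then some false else none) subset_rfl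
    (fun b hb => if_neg hb.2) (fun b hb => if_pos hb.1) (fun b hb => by
      by_cases h1 : b.Lic (Ballot.mk 1 z)
      · rw [if_pos h1, if_pos (hsub b h1)]
      · rw [if_neg h1, if_neg fun h2 => hb ⟨h2, h1⟩])
  obtain ⟨c₇, s₇, hc⟩ := hc.consensus (M' := batch .vote {Ballot.mk 2 z} true)
    (E' := fun _ _ _ => True) hI
    fun v hv rc n s hn hst hrc => by
      obtain ⟨⟨hp, hcand⟩, hw⟩ := hn.extra
      refine ⟨_, _, _, .preparedHigh (Ballot.mk 2 z) (fun b hb => ?_) (hp ▸ h12) hcand.le, rfl,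
        hst, hn.proposed, hn.ready, hn.delivered, ?_, trivial⟩
      · rw [hn.delivered]
        exact if_pos hb
      · rintro _ ⟨b, rfl, rfl⟩
        exact ⟨_, Or.inr rfl, _, rfl, hw, rfl⟩
  -- The instance of `⟨2, z⟩` is untouched: this ballot shares its value with both prepared ballots,
  -- so it was never aborted.
  obtain ⟨c₈, s₈, hc⟩ := hc.ready hI (bs := {Ballot.mk 2 z}) (a := true) subset_rfl
    (by
      rintro b rfl (h | h)
      · exact h.2 rfl
      · exact h.1.2 rfl)
    (fun _ _ _ _ h => h)
  obtain ⟨c₉, s₉, hc⟩ := hc.deliver hI (bs := {Ballot.mk 2 z}) (a := true)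
    (d' := fun b => if b = Ballot.mk 2 z then some true else
      if b.Lic (Ballot.mk 2 z) then some false else none) subset_rfl
    (by rintro b rfl; exact if_neg fun h => h.2 rfl) (fun b hb => if_pos hb)
    (fun b hb => if_neg hb)
  refine ⟨c₉, s₁.trans <| s₂.trans <| s₃.trans <| s₄.trans <| s₅.trans <| s₆.trans <|
    s₇.trans <| s₈.trans s₉, fun v hv => ⟨(hc.holds v hv).proposed, hc.running v hv, ?_⟩⟩
  rw [(hc.holds v hv).delivered]
  exact if_pos rfl

end Rounds

/-! ### Proposals and the first ready messages -/

section StartNode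

variable {V Val : Type*} [LinearOrder Val]

/-- The state of a node that has done nothing but propose. -/
def startNode (x : Option Val) (R : Set (Ballot Val)) : Node Val :=
  match x with
  | none => { Node.init Val with ready := R }
  | some x =>
    { Node.init Val with
      cons := { Consensus.init Val with cand := Ballot.mk 1 x, proposed := true }
      voted := {b | b.Lic (Ballot.mk 1 x)}
      ready := R }

/-- The messages of a node that has done nothing but propose. -/
def startSent (x : Option Val) : Set (Batch Val) :=
  {m | ∃ y, x = some y ∧ m = batch .vote {b | b.Lic (Ballot.mk 1 y)} false}

theorem startSent_finite (x : Option Val) : (startSent x).Finite := by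
  refine Set.Subsingleton.finite ?_
  rintro _ ⟨y, hy, rfl⟩ _ ⟨y', hy', rfl⟩
  rw [hy, Option.some.injEq] at hy'
  rw [hy']

@[simp] theorem startNode_stopped (x : Option Val) (R : Set (Ballot Val)) :
    (startNode x R).cons.stopped = false := by
  cases x <;> rfl

@[simp] theorem startNode_proposed (x : Option Val) (R : Set (Ballot Val)) :
    (startNode x R).cons.proposed = x.isSome := by
  cases x <;> rfl

@[simp] theorem startNode_ready (x : Option Val) (R : Set (Ballot Val)) :
    (startNode x R).ready = R := by
  cases x <;> rfl

theorem startNode_with_ready (x : Option Val) (R R' : Set (Ballot Val)) :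
    { startNode x R with ready := R' } = startNode x R' := by
  cases x <;> rfl

/-- The configuration after the proposals `p`. -/
def startCfg (p : V → Option Val) : Config V (Node Val) (Batch Val) where
  node v := startNode (p v) ∅
  sent v := startSent (p v)
  rcvd _ _ := ∅

theorem startCfg_none : (startCfg fun _ : V => (none : Option Val)) =
    { node := fun _ => Node.init Val, sent := fun _ => ∅, rcvd := fun _ _ => ∅ } := by
  simp [startCfg, startSent, startNode, Node.init]

end StartNode

section Start

variable {V : Type*} [Fintype V] [DecidableEq V] {Val : Type*} [LinearOrder Val] {ok : Set V}
  {F : SubjectiveFBQS ok} {I : Set V}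

theorem exists_propose {p : V → Option Val} {v : V} (hv : v ∈ ok) (hp : p v = none) (x : Val) :
    ∃ e, Step F Val (startCfg p) e (startCfg (Function.update p v (some x))) ∧
      e.filterMap (vis I) = ([.hist (.propose v x)] : List (AEvent V Val)).filterMap (vis I) := by
  have hn : (startCfg p).node v = Node.init Val := by simp [startCfg, hp, startNode, Node.init]
  have hl := Local.propose (S := F.view ⟨v, hv⟩) (v := v) (rc := (startCfg p).rcvd v)
    (n := (startCfg p).node v) x (by rw [hn]; rfl)
  obtain ⟨e, he, hh⟩ := exists_act (I := I) hv (by rw [hn]; rfl) hl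
  refine ⟨e, ?_, hh.trans ?_⟩
  · convert he using 1
    simp only [afterAct, startCfg, Config.mk.injEq, and_true]
    constructor
    · funext u
      by_cases hu : u = v
      · subst hu
        simp [startNode, Node.init, hp]
      · simp [hu]
    · funext u
      by_cases hu : u = v
      · subst hu
        simp [startSent, startNode, hp, Node.voteMsgs, batch, Node.init, eq_comm]
      · simp [hu]
  have : vis I (.voteBatch v {b' | b'.Lic (Ballot.mk 1 x)} false : AEvent V Val) = none := by
    unfold vis visible
    split_ifs <;> rfl
  simp only [List.filterMap_cons, List.filterMap_nil, this]

/-- All correct nodes outside of `I` propose `z`. -/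
theorem silent_propose {p : V → Option Val} (hp : ∀ v ∉ I, p v = none) (z : Val) :
    ∃ p', Silent (Step F Val) (vis I) (startCfg p) (startCfg p') ∧ (∀ v ∈ I, p' v = p v) ∧
      ∀ v ∈ ok, v ∉ I → p' v = some z := by
  have key : ∀ s : Finset V, (∀ v ∈ s, v ∈ ok ∧ v ∉ I) →
      ∃ p', Silent (Step F Val) (vis I) (startCfg p) (startCfg p') ∧ (∀ v ∉ s, p' v = p v) ∧
        ∀ v ∈ s, p' v = some z := by
    intro s
    induction s using Finset.induction_on with
    | empty => exact fun _ => ⟨p, .refl, fun _ _ => rfl, by simp⟩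
    | insert v s hvs ih =>
      intro hs
      obtain ⟨p', h1, h2, h3⟩ := ih fun u hu => hs u (Finset.mem_insert_of_mem hu)
      obtain ⟨hv, hvI⟩ := hs v (Finset.mem_insert_self _ _)
      obtain ⟨e, he, hh⟩ := exists_propose (F := F) (I := I) hv ((h2 v hvs).trans (hp v hvI)) z
      refine ⟨_, h1.trans (.single ⟨e, he, hh.trans ?_⟩), fun u hu => ?_, fun u hu => ?_⟩
      · refine filterMap_visible_of_notMem fun e he => ?_
        rw [List.mem_singleton] at he
        subst he
        exact hvI
      · have huv : u ≠ v := fun h => hu (h ▸ Finset.mem_insert_self _ _)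
        rw [Function.update_of_ne huv]
        exact h2 u fun h => hu (Finset.mem_insert_of_mem h)
      · by_cases huv : u = v
        · subst huv
          simp
        · rw [Function.update_of_ne huv]
          exact h3 u ((Finset.mem_insert.1 hu).resolve_left huv)
  classical
  obtain ⟨p', h1, h2, h3⟩ := key (Finset.univ.filter fun v => v ∈ ok ∧ v ∉ I) (by simp)
  exact ⟨p', h1, fun v hv => h2 v (by simp [hv]), fun v hv hvI => h3 v (by simp [hv, hvI])⟩

/-- The correct nodes have proposed as in `p`, those in `R` have sent ready messages for aborting
all ballots below `⟨1, z⟩`, and all correct nodes have received these votes and ready messages, and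
the same messages from the faulty nodes. -/
structure Readied (ok : Set V) (p : V → Option Val) (z : Val) (R : Set V)
    (c : Config V (Node Val) (Batch Val)) : Prop where
  node_mem : ∀ v ∈ R, c.node v = startNode (p v) {b | b.Lic (Ballot.mk 1 z)}
  node_notMem : ∀ v ∉ R, c.node v = startNode (p v) ∅
  sent_mem : ∀ v ∈ R, c.sent v =
    startSent (p v) ∪ {batch .ready {b | b.Lic (Ballot.mk 1 z)} false}
  sent_notMem : ∀ v ∉ R, c.sent v = startSent (p v)
  rcvd_ok : ∀ v ∈ ok, ∀ u ∈ ok, c.sent u ⊆ c.rcvd v u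
  rcvd_vote : ∀ v ∈ ok, ∀ u ∉ ok, batch .vote {b | b.Lic (Ballot.mk 1 z)} false ∈ c.rcvd v u
  rcvd_ready : ∀ v ∈ ok, ∀ u ∉ ok, batch .ready {b | b.Lic (Ballot.mk 1 z)} false ∈ c.rcvd v u

theorem Readied.of_exchange {p : V → Option Val} {z : Val} {R : Set V}
    {c : Config V (Node Val) (Batch Val)}
    (h1 : ∀ v ∈ R, c.node v = startNode (p v) {b | b.Lic (Ballot.mk 1 z)})
    (h2 : ∀ v ∉ R, c.node v = startNode (p v) ∅)
    (h3 : ∀ v ∈ R, c.sent v = startSent (p v) ∪ {batch .ready {b | b.Lic (Ballot.mk 1 z)} false})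
    (h4 : ∀ v ∉ R, c.sent v = startSent (p v)) :
    ∃ c', Silent (Step F Val) (vis I) c c' ∧ Readied ok p z R c' := by
  classical
  have hrun : ∀ v ∈ ok, (c.node v).cons.stopped = false := by
    intro v _
    by_cases hv : v ∈ R
    · simp [h1 v hv]
    · simp [h2 v hv]
  have hfin : ∀ v, (c.sent v).Finite := by
    intro v
    by_cases hv : v ∈ R
    · rw [h3 v hv]
      exact (startSent_finite _).union (Set.finite_singleton _)
    · rw [h4 v hv]
      exact startSent_finite _
  obtain ⟨c', hc, he, hr⟩ := silent_receive_all (F := F) (I := I) c subset_rfl hrun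
    -- Faulty nodes may send anything; here they send the votes and the ready messages that help.
    (fun u => if u ∈ ok then c.sent u else {batch .vote {b | b.Lic (Ballot.mk 1 z)} false,
      batch .ready {b | b.Lic (Ballot.mk 1 z)} false})
    (fun u => by split_ifs <;> [exact hfin u; exact Set.toFinite _])
    (fun u hu => by rw [if_pos hu])
  refine ⟨c', hc, ?_, ?_, ?_, ?_, fun v hv u hu => ?_, fun v hv u hu => ?_, fun v hv u hu => ?_⟩
  · rwa [he.node]
  · rwa [he.node]
  · rwa [he.sent]
  · rwa [he.sent]
  · rw [he.sent]
    simpa [hu] using hr v hv u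
  · exact hr v hv u (by simp [hu])
  · exact hr v hv u (by simp [hu])

variable {p : V → Option Val} {z : Val} {R : Set V} {c : Config V (Node Val) (Batch Val)}

/-- One more node sends its ready messages. -/
theorem Readied.insert (h : Readied ok p z R c) {v : V} (hv : v ∈ ok) (hvR : v ∉ R)
    (hl : ∀ b : Ballot Val, b.Lic (Ballot.mk 1 z) →
      (∃ U, (F.view ⟨v, hv⟩).IsQuorum U ∧ v ∈ U ∧ ∀ u ∈ U, Got (c.rcvd v u) ⟨.vote, b, false⟩) ∨
      ∃ B, (F.view ⟨v, hv⟩).IsBlocking v B ∧ ∀ u ∈ B, Got (c.rcvd v u) ⟨.ready, b, false⟩) :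
    ∃ c', Silent (Step F Val) (vis I) c c' ∧ Readied ok p z (insert v R) c' := by
  have hn := h.node_notMem v hvR
  have hloc : Local (F.view ⟨v, hv⟩) v (c.rcvd v) (c.node v) _ _ _ :=
    .ready {b | b.Lic (Ballot.mk 1 z)} false ⟨⊥, Ballot.bot_lt_mk _ _, by simp⟩
      fun b hb => ⟨by simp [hn], hl b hb⟩
  have hs := silent_act (I := I) hv (by simp [hn]) hloc rfl
  have hnode : ({ c.node v with ready := (c.node v).ready ∪ {b | b.Lic (Ballot.mk 1 z)} } : Node Val) =
      startNode (p v) {b | b.Lic (Ballot.mk 1 z)} := by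
    rw [hn, startNode_with_ready]
    simp
  rw [hnode] at hs
  have hne : ∀ u, u ∉ Insert.insert v R → u ≠ v ∧ u ∉ R := fun u hu =>
    ⟨fun h => hu (h ▸ Set.mem_insert _ _), fun h => hu (Set.mem_insert_of_mem _ h)⟩
  obtain ⟨c', hs', hc'⟩ := Readied.of_exchange (F := F) (I := I) (p := p) (z := z)
    (R := Insert.insert v R) (c := afterAct c v (startNode (p v) {b | b.Lic (Ballot.mk 1 z)})
      (some {m | ∃ b ∈ {b : Ballot Val | b.Lic (Ballot.mk 1 z)}, m = ⟨.ready, b, false⟩}))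
    (fun u hu => by
      by_cases huv : u = v
      · subst huv
        simp [afterAct]
      · simpa [afterAct, huv] using h.node_mem u (hu.resolve_left huv))
    (fun u hu => by simpa [afterAct, (hne u hu).1] using h.node_notMem u (hne u hu).2)
    (fun u hu => by
      by_cases huv : u = v
      · subst huv
        simp [afterAct, h.sent_notMem u hvR, batch, eq_comm]
      · simpa [afterAct, huv] using h.sent_mem u (hu.resolve_left huv))
    (fun u hu => by simpa [afterAct, (hne u hu).1] using h.sent_notMem u (hne u hu).2)
  exact ⟨c', hs.trans hs', hc'⟩

/-- All intact nodes send ready messages for aborting the ballots below `⟨1, z⟩`. -/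
theorem Readied.exists_superset
    (hI : ∀ v ∈ I, F.CanReady I {v | v ∈ I ∧ ∃ x, z ≤ x ∧ p v = some x} v)
    (hp : ∀ v ∈ ok, v ∉ I → p v = some z) (h : Readied ok p z R c) :
    ∃ R' c', Silent (Step F Val) (vis I) c c' ∧ Readied ok p z R' c' ∧ I ⊆ R' := by
  classical
  -- Induction on the number of nodes that are not ready yet.
  induction hk : (Finset.univ.filter (· ∉ R)).card using Nat.strong_induction_on
    generalizing R c with
  | _ k ih =>
    subst hk
    by_cases hIR : I ⊆ R
    · exact ⟨R, c, .refl, h, hIR⟩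
    have hvote : ∀ (v : V), v ∈ ok → ∀ U : Set V,
        U ∩ I ⊆ {v | v ∈ I ∧ ∃ x, z ≤ x ∧ p v = some x} → ∀ b : Ballot Val,
        b.Lic (Ballot.mk 1 z) → ∀ u ∈ U, Got (c.rcvd v u) ⟨.vote, b, false⟩ := by
      intro v hv U hU b hb u hu
      by_cases huok : u ∈ ok
      · have hx : ∃ x, z ≤ x ∧ p u = some x := by
          by_cases huI : u ∈ I
          · exact (hU ⟨hu, huI⟩).2
          · exact ⟨z, le_rfl, hp u huok huI⟩
        obtain ⟨x, hzx, hx⟩ := hx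
        have hsent : startSent (p u) ⊆ c.sent u := by
          by_cases huR : u ∈ R
          · rw [h.sent_mem u huR]
            exact Set.subset_union_left
          · rw [h.sent_notMem u huR]
        -- A proposal of `x ≥ z` votes `false` for all ballots below `⟨1, x⟩`, in particular for
        -- those below `⟨1, z⟩`.
        refine got_batch (h.rcvd_ok v hv u huok (hsent ⟨x, hx, rfl⟩)) ?_
        refine Ballot.lic_mk_one_iff.2 (hb.1.trans_le ?_)
        rcases hzx.lt_or_eq with h | rfl
        · exact (Ballot.mk_lt_mk.2 (Or.inr ⟨rfl, h⟩)).le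
        · exact le_rfl
      · exact got_batch (h.rcvd_vote v hv u huok) hb
    have step : ∃ v, ∃ hv : v ∈ ok, v ∉ R ∧ ∀ b : Ballot Val, b.Lic (Ballot.mk 1 z) →
        (∃ U, (F.view ⟨v, hv⟩).IsQuorum U ∧ v ∈ U ∧
          ∀ u ∈ U, Got (c.rcvd v u) ⟨.vote, b, false⟩) ∨
        ∃ B, (F.view ⟨v, hv⟩).IsBlocking v B ∧
          ∀ u ∈ B, Got (c.rcvd v u) ⟨.ready, b, false⟩ := by
      -- If no further node could become ready, `R` would be closed under both rules of `CanReady`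
      -- and would include `I`.
      by_contra! hcon
      refine hIR fun v hvI => ?_
      have hv := hI v hvI
      -- A derivation of `CanReady` may pass through correct nodes outside `I`, so the induction
      -- must not assume membership.
      clear hvI
      induction hv with
      | quorum v U hU hvU hUI =>
        by_contra hvR
        obtain ⟨b, hb, h1, _⟩ := hcon v v.2 hvR
        obtain ⟨u, hu, hn⟩ := h1 U hU hvU
        exact hn (hvote v v.2 U hUI b hb u hu)
      | blocking v B hB _ ihB =>
        by_contra hvR
        obtain ⟨b, hb, _, h2⟩ := hcon v v.2 hvR
        obtain ⟨u, hu, hn⟩ := h2 B hB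
        refine hn ?_
        by_cases huok : u ∈ ok
        · refine got_batch (bs := {b | b.Lic (Ballot.mk 1 z)}) (h.rcvd_ok v v.2 u huok ?_) hb
          rw [h.sent_mem u (ihB u hu huok)]
          exact Or.inr rfl
        · exact got_batch (h.rcvd_ready v v.2 u huok) hb
    obtain ⟨v, hv, hvR, hl⟩ := step
    obtain ⟨c', hs, hc'⟩ := h.insert (I := I) hv hvR hl
    obtain ⟨R'', c'', hs', hc'', hR''⟩ := ih _ (Finset.card_lt_card (by
      rw [Finset.ssubset_iff_of_subset (fun u hu => by
        simp only [Finset.mem_filter, Finset.mem_univ, true_and, Set.mem_insert_iff, not_or] at hu ⊢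
        exact hu.2)]
      exact ⟨v, by simpa using hvR, by simp⟩)) hc' rfl
    exact ⟨R'', c'', hs.trans hs', hc'', hR''⟩

/-- When the proposals support `z`, all intact nodes can deliver `true` for `⟨2, z⟩`. -/
theorem silent_deliver (hI : F.IsIntact I) (hp : ∀ v ∉ I, p v = none)
    (hz : ∀ v ∈ I, F.CanReady I {v | v ∈ I ∧ ∃ x, z ≤ x ∧ p v = some x} v) :
    ∃ c, Silent (Step F Val) (vis I) (startCfg p) c ∧ ∀ v ∈ I,
      (c.node v).cons.proposed = (p v).isSome ∧ (c.node v).cons.stopped = false ∧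
      (c.node v).delivered (Ballot.mk 2 z) = some true := by
  obtain ⟨p', s₁, hp', hp''⟩ := silent_propose (F := F) hp z
  obtain ⟨c₂, s₂, h₂⟩ := Readied.of_exchange (F := F) (I := I) (p := p') (z := z) (R := ∅)
    (c := startCfg p') (by simp) (fun _ _ => rfl) (by simp) (fun _ _ => rfl)
  obtain ⟨R, c₃, s₃, h₃, hR⟩ := h₂.exists_superset (F := F) (I := I)
    (fun v hv => (hz v hv).mono (by
      rintro u ⟨huI, x, hx, hu⟩
      exact ⟨huI, x, hx, (hp' u huI).trans hu⟩)) hp''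
  have hstage : Stage I (Progress (fun v => (p v).isSome) {b | b.Lic (Ballot.mk 1 z)}
      (fun _ => none) (batch .ready {b | b.Lic (Ballot.mk 1 z)} false) fun k w s =>
      (k.prepared = ⊥ ∧ k.round = 0) ∧
      (∀ b ∈ w, b.val ≠ some z → Got s ⟨.vote, b, false⟩) ∧ Ballot.mk 2 z ∉ w) c₃ := by
    refine ⟨fun v hv => ?_, fun v hv => ?_, fun v hv => ?_, fun v hv u hu =>
      h₃.rcvd_ok v (hI.2.1 hv) u (hI.2.1 hu)⟩
    · rw [h₃.node_mem v (hR hv), h₃.sent_mem v (hR hv), hp' v hv]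
      refine ⟨startNode_proposed _ _, startNode_ready _ _, ?_, ?_, ?_⟩
      · cases p v <;> rfl
      · rintro _ ⟨b, hb, rfl⟩
        exact got_batch (Or.inr rfl) hb
      · rcases hx : p v with _ | x
        · exact ⟨⟨rfl, rfl⟩, fun b hb => absurd hb (Set.notMem_empty b), Set.notMem_empty _⟩
        -- The only votes so far are those of the proposal. They all abort, and they concern ballots
        -- below `⟨1, x⟩`, hence not `⟨2, z⟩`.
        · refine ⟨⟨rfl, rfl⟩, fun b hb _ => got_batch (Or.inl ⟨x, rfl, rfl⟩) hb, fun h => ?_⟩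
          refine lt_asymm h.1 (Ballot.mk_lt_mk.2 (Or.inl ?_))
          decide
    · rw [h₃.node_mem v (hR hv)]
      exact startNode_stopped _ _
    · rw [h₃.sent_mem v (hR hv)]
      exact (startSent_finite _).union (Set.finite_singleton _)
  obtain ⟨c₄, s₄, h₄⟩ := hstage.deliver_two hI
  exact ⟨c₄, s₁.trans <| s₂.trans <| s₃.trans s₄, h₄⟩

end Start

end ASCP

/-! ## Histories of the concrete protocol in the abstract protocol -/

section Simulation

variable {V : Type*} [Fintype V] [DecidableEq V] {Val : Type*} [LinearOrder Val] {ok : Set V}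
  {F : SubjectiveFBQS ok} {I : Set V} (X : CSCP.Exec Val F)

/-- Before the first decision of an intact node, the abstract configuration contains nothing but
the proposals of the intact nodes. -/
def BeforeDecision (I : Set V) (n : ℕ) (c : Config V (ASCP.Node Val) (Batch Val)) : Prop :=
  ∃ p : V → Option Val, c = ASCP.startCfg p ∧ (∀ v ∉ I, p v = none) ∧
    (∀ v ∈ I, ∀ x, CSCP.Proposed X n v x → p v = some x) ∧
    ∀ v ∈ I, CSCP.flags X n v = ((p v).isSome, false)

/-- From the first decision on, the intact nodes have delivered `true` for `⟨2, z⟩`. -/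
def AfterDecision (I : Set V) (z : Val) (n : ℕ) (c : Config V (ASCP.Node Val) (Batch Val)) : Prop :=
  ∀ v ∈ I, CSCP.flags X n v = ((c.node v).cons.proposed, (c.node v).cons.stopped) ∧
    (c.node v).delivered (Ballot.mk 2 z) = some true

theorem beforeDecision_zero : BeforeDecision X I 0 (ASCP.startCfg fun _ => none) := by
  refine ⟨_, rfl, fun _ _ => rfl, ?_, fun v _ => ?_⟩
  · rintro v _ x ⟨j, hj, _⟩
    exact absurd hj (Nat.not_lt_zero j)
  · simp [CSCP.flags, X.start, CSCP.Node.init, Consensus.init]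

/-- Without decisions, only proposals have to be matched, and a proposal is enabled without any
received message; every other concrete step is answered by idling. -/
theorem BeforeDecision.step (hI : F.IsIntact I) {n : ℕ}
    {c : Config V (ASCP.Node Val) (Batch Val)} (h : BeforeDecision X I n c)
    (hn : ¬ ∃ v z, CSCP.hist X I n = [.decide v z]) :
    ∃ e c', ASCP.Step F Val c e c' ∧ e.filterMap (ASCP.vis I) = CSCP.hist X I n ∧
      BeforeDecision X I (n + 1) c' := by
  obtain ⟨p, rfl, hp, hprop, hflags⟩ := h
  have hsucc : ∀ {v : V} {x : Val}, v ∈ I → CSCP.Proposed X (n + 1) v x →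
      CSCP.Proposed X n v x ∨ .propose v x ∈ CSCP.hist X I n := by
    rintro v x hv ⟨j, hj, he⟩
    rcases Nat.lt_succ_iff_lt_or_eq.1 hj with hj | rfl
    · exact Or.inl ⟨j, hj, he⟩
    · exact Or.inr (CSCP.propose_mem_hist X hv he)
  rcases CSCP.hist_cases X hI n with ⟨h0, hf⟩ | ⟨v, hv, x, h1, hf, hf', hother⟩ |
    ⟨v, _, _, z, h2, _⟩
  · refine ⟨[], _, .idle _, h0.symm, p, rfl, hp, fun v hv x hx => ?_,
      fun v hv => (hf v hv).trans (hflags v hv)⟩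
    rcases hsucc hv hx with hx | hx
    · exact hprop v hv x hx
    · simp [h0] at hx
  · have hpv : p v = none := by
      have := hflags v hv
      rw [hf, Prod.mk.injEq] at this
      simpa using this.1.symm
    obtain ⟨e, he, hh⟩ := ASCP.exists_propose (F := F) (I := I) (hI.2.1 hv) hpv x
    refine ⟨e, _, he, ?_, _, rfl, fun u hu => ?_, fun u hu y hy => ?_, fun u hu => ?_⟩
    · rw [hh, h1, filterMap_visible_of_mem]
      · rfl
      · intro e he
        rw [List.mem_singleton] at he
        subst he
        exact hv
    · have huv : u ≠ v := fun h => hu (h ▸ hv)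
      rw [Function.update_of_ne huv]
      exact hp u hu
    · rcases hsucc hu hy with hy | hy
      · have huv : u ≠ v := by
          rintro rfl
          simp [hprop u hu y hy] at hpv
        rw [Function.update_of_ne huv]
        exact hprop u hu y hy
      · rw [h1, List.mem_singleton, HistEvent.propose.injEq] at hy
        obtain ⟨rfl, rfl⟩ := hy
        exact Function.update_self _ _ _
    · by_cases huv : u = v
      · subst huv
        simp [hf']
      · rw [Function.update_of_ne huv, hother u hu huv]
        exact hflags u hu
  · exact absurd ⟨v, z, h2⟩ hn

/-- The delivered `true` for `⟨2, z⟩` keeps the decision of `z` enabled at every intact node that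
has not stopped, and `hz` excludes other decisions. Messages no longer matter. -/
theorem AfterDecision.step (hI : F.IsIntact I) {z : Val}
    (hz : ∀ n, ∀ v ∈ I, ∀ b y, ⟨.ready, .cmt b⟩ ∈ (X.cfg n).sent v → b.val = some y → y = z)
    {n : ℕ} {c : Config V (ASCP.Node Val) (Batch Val)} (h : AfterDecision X I z n c) :
    ∃ e c', ASCP.Step F Val c e c' ∧ e.filterMap (ASCP.vis I) = CSCP.hist X I n ∧
      AfterDecision X I z (n + 1) c' := by
  have hact : ∀ v ∈ I, ∀ (n' : ASCP.Node Val) (o : Option (Batch Val)),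
      CSCP.flags X (n + 1) v = (n'.cons.proposed, n'.cons.stopped) →
      n'.delivered = (c.node v).delivered →
      (∀ u ∈ I, u ≠ v → CSCP.flags X (n + 1) u = CSCP.flags X n u) →
      AfterDecision X I z (n + 1) (ASCP.afterAct c v n' o) := by
    intro v hv n' o hf hd hother u hu
    by_cases huv : u = v
    · subst huv
      simpa [ASCP.afterAct, hd] using ⟨hf, (h u hu).2⟩
    · simpa [ASCP.afterAct, huv, hother u hu huv] using h u hu
  rcases CSCP.hist_cases X hI n with ⟨h0, hf⟩ | ⟨v, hv, x, h1, hf, hf', hother⟩ |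
    ⟨v, hv, b, y, h2, hb, hm, hf, hf', hother⟩
  · exact ⟨[], _, .idle _, h0.symm, fun v hv => by rw [hf v hv]; exact h v hv⟩
  · obtain ⟨hv1, hv2⟩ := h v hv
    rw [hf, Prod.mk.injEq] at hv1
    obtain ⟨e, he, hh⟩ := ASCP.exists_act (I := I) (hI.2.1 hv) hv1.2.symm
      (ASCP.Local.propose (S := F.view ⟨v, hI.2.1 hv⟩) (v := v) (rc := c.rcvd v) (n := c.node v) x
        hv1.1.symm)
    refine ⟨e, _, he, ?_, hact v hv _ _ ?_ rfl hother⟩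
    · rw [hh, h1, filterMap_visible_of_mem]
      · rfl
      · intro e he
        simp only [List.mem_cons, List.not_mem_nil, or_false] at he
        rcases he with rfl | rfl <;> exact hv
    · rw [hf']
      exact congrArg _ hv1.2
  · obtain rfl := hz n v hv b y hm hb
    obtain ⟨hv1, hv2⟩ := h v hv
    rw [hv1] at hf
    obtain ⟨e, he, hh⟩ := ASCP.exists_act (I := I) (hI.2.1 hv) hf
      (ASCP.Local.decide (S := F.view ⟨v, hI.2.1 hv⟩) (v := v) (rc := c.rcvd v) (n := c.node v)
        _ y hv2 (Ballot.val_mk 2 y))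
    refine ⟨e, _, he, ?_, hact v hv _ _ ?_ rfl hother⟩
    · rw [hh, h2, filterMap_visible_of_mem]
      · rfl
      · intro e he
        rw [List.mem_singleton] at he
        subst he
        exact hv
    · rw [hf', hv1]

/-- The abstract protocol produces the history of the intact nodes in the concrete execution. -/
theorem produces_hist (hI : F.IsIntact I) :
    Produces (ASCP.Step F Val) (ASCP.vis I) (ASCP.startCfg fun _ => none) (CSCP.hist X I) := by
  classical
  by_cases hdec : ∃ n v z, CSCP.hist X I n = [.decide v z]
  · refine Produces.of_invariant_until (R := BeforeDecision X I) (Nat.find hdec)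
      (beforeDecision_zero X) (fun n hn c hc => hc.step X hI (Nat.find_min hdec hn)) ?_
    have hT := Nat.find_spec hdec
    generalize Nat.find hdec = T at hT
    rintro _ ⟨p, rfl, hp, hprop, hflags⟩
    rcases CSCP.hist_cases X hI T with ⟨h0, _⟩ | ⟨v, _, x, h1, _⟩ | ⟨v, hv, b, z, _, hb, hm, _⟩
    · simp [h0] at hT
    · simp [h1] at hT
    -- The deciding node was ready to commit `b` already at step `T`, so its value `z` is supported
    -- by proposals from before `T`, all of which the abstract run has copied.
    · have hsup := ((CSCP.valid X hI T).1 v hv).ready_cmt b z hm hb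
      obtain ⟨c, hs, hc⟩ := ASCP.silent_deliver (F := F) (z := z) hI hp fun u hu =>
        (hsup u hu).mono (by
          rintro w ⟨hw, x, hx, hpx⟩
          exact ⟨hw, x, hx, hprop w hw x hpx⟩)
      refine Produces.of_silent hs (Produces.of_invariant
        (R := fun k => AfterDecision X I z (T + k)) (fun u hu => ?_)
        fun k c hc => hc.step X hI fun n u hu b' y hm' hy => ?_)
      · obtain ⟨h1, h2, h3⟩ := hc u hu
        exact ⟨by rw [h1, h2]; exact hflags u hu, h3⟩
      -- Ready messages for committing at any two steps, past or future, carry the same value.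
      · have := CSCP.agreement X hI hu hv hm' hm
        rwa [hy, hb, Option.some.injEq] at this
  · exact Produces.of_invariant (R := BeforeDecision X I) (beforeDecision_zero X)
      fun n c hc => hc.step X hI fun h => hdec ⟨n, h⟩

end Simulation

theorem mainTheorem6 {V : Type*} [Fintype V] [DecidableEq V] {Val : Type*} [LinearOrder Val]
    {ok : Set V} (F : SubjectiveFBQS ok) (I : Set V) (hI : F.IsIntact I)
    (X : CSCP.Exec Val F) :
    ∃ Y : ASCP.Exec Val F,
      CEvent.history (CEvent.project I X.trace) = AEvent.history (AEvent.project I Y.trace) := by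
  have h := produces_hist X hI
  rw [ASCP.startCfg_none] at h
  obtain ⟨Y, hY⟩ := ASCP.exists_exec_of_produces h
  exact ⟨Y, (CSCP.history_project X).trans hY.symm⟩
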